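/- For a finite integer $n\ge 1$ or $n=\infty$, a stochastic problem of size $n$ on $\mathbb{R}^d$ consists of differentiable functions $f_\xi:\mathbb{R}^d\to\mathbb{R}$, $\xi\in\Xi$, and a probability distribution $\mathcal D$ on $\Xi$ which is the uniform distribution on an $n$-element set $\Xi$ if $n<\infty$ and an atomless distribution on an infinite set $\Xi$ if $n=\infty$; its objective is $f(x)=\mathbb{E}_{\xi\sim\mathcal D}[f_\xi(x)]$, where $f$ is differentiable with $\nabla f(x)=\mathbb{E}_{\xi}[\nabla f_\xi(x)]$. A run of a (randomized) linear-span first-order algorithm on it, started at $x^0$, is a random sequence of points $x^t$ and indices $i_t\in\Xi$ ($t\ge 0$) such that, for every $t\ge1$, almost surely $$x^t\in\mathrm{Lin}\{x^0,\dots,x^{t-1},\nabla f_{i_0}(x^0),\dots,\nabla f_{i_{t-1}}(x^{t-1})\},$$ together with a (possibly random) number $N\in\{0,1,2,\dots\}$ of computed stochastic gradients and a random output $\widehat x\in\mathrm{Lin}\{x^0,\dots,x^{N-1},\nabla f_{i_0}(x^0),\dots,\nabla f_{i_{N-1}}(x^{N-1})\}$ (with $\widehat x\in\mathrm{Lin}\{x^0\}$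 if $N=0$). The indices, the stopping and the output may be chosen in any way. There are absolute constants $c,c_1>0$ such that the following holds for all $L>0$, $\Delta_0>0$, $\sigma>0$, all $n\in\{1,2,3,\dots\}\cup\{\infty\}$ and all $0<\epsilon\le c_1\sqrt{\Delta_0L}$. Put $b=\min\{\sigma^2/\epsilon^2,\,n\}$. There is a dimension $d$ such that for every starting point $x^0\in\mathbb{R}^d$ there is a stochastic problem of size $n$ on $\mathbb{R}^d$ satisfying - bounded variance: $\mathbb{E}_\xi\|\nabla f_\xi(x)-\nabla f(x)\|^2\le\sigma^2$ for all $x\in\mathbb{R}^d$, - average $L$-smoothness: $\mathbb{E}_\xi\|\nabla f_\xi(x)-\nabla f_\xi(y)\|^2\le L^2\|x-y\|^2$ for all $x,y\in\mathbb{R}^d$, - $f$ attains its minimum $f^*$, and $f(x^0)-f^*=\Delta_0$, such that every run of a linear-span first-order algorithm, started at $x^0$, that finds an $\epsilon$-approximate solution, i.e. $\mathbb{E}\|\nabla f(\widehat x)\|\le\epsilon$, needs in expectation at least $$\mathbb{E}[N]\;\ge\; c\left(b+\frac{\Delta_0L\sqrt b}{\epsilon^2}\right)$$ stochastic gradient computations.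 -/

import Mathlib

open MeasureTheory
open scoped ENNReal

noncomputable section

/-- The law `D` of the sample index has size `n`: for finite `n` it is the uniform distribution on
an `n`-element set (so that expectations are averages `(1/n) ∑ i`), and for `n = ∞` it is a
probability distribution without atoms on an infinite set. (For `n = ∞` the value `n⁻¹` is `0`.) -/
def IsSampleLaw {Ξ : Type} [MeasurableSpace Ξ] (n : ℕ∞) (D : Measure Ξ) : Prop :=
  IsProbabilityMeasure D ∧ ENat.card Ξ = n ∧ ∀ ξ : Ξ, D {ξ} = (n : ℝ≥0∞)⁻¹

/-- The objective `f(x) = 𝔼_{ξ ∼ D}[F(x, ξ)]`. The individual functions are `f_ξ = F(·, ξ)`. -/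
def objective {d : ℕ} {Ξ : Type} [MeasurableSpace Ξ] (D : Measure Ξ)
    (F : EuclideanSpace ℝ (Fin d) → Ξ → ℝ) (x : EuclideanSpace ℝ (Fin d)) : ℝ :=
  ∫ ξ, F x ξ ∂D

/-- The stochastic gradient `∇f_ξ(x)`. -/
def stochGrad {d : ℕ} {Ξ : Type} (F : EuclideanSpace ℝ (Fin d) → Ξ → ℝ) (ξ : Ξ)
    (x : EuclideanSpace ℝ (Fin d)) : EuclideanSpace ℝ (Fin d) :=
  gradient (fun y => F y ξ) x

/-- `f = 𝔼_ξ[f_ξ]` is a well-posed stochastic problem: the individual functions are differentiable,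
the expectations of values and gradients exist, and `f` is differentiable with
`∇f(x) = 𝔼_ξ[∇f_ξ(x)]`. -/
structure IsStochasticProblem {d : ℕ} {Ξ : Type} [MeasurableSpace Ξ] (D : Measure Ξ)
    (F : EuclideanSpace ℝ (Fin d) → Ξ → ℝ) : Prop where
  differentiable : ∀ ξ, Differentiable ℝ (fun x => F x ξ)
  integrable_value : ∀ x, Integrable (F x) D
  integrable_grad : ∀ x, Integrable (fun ξ => stochGrad F ξ x) D
  hasGradientAt : ∀ x, HasGradientAt (objective D F) (∫ ξ, stochGrad F ξ x ∂D) x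

/-- Bounded variance: `𝔼_ξ ‖∇f_ξ(x) - ∇f(x)‖² ≤ σ²` for all `x`. -/
def BoundedVariance {d : ℕ} {Ξ : Type} [MeasurableSpace Ξ] (D : Measure Ξ)
    (F : EuclideanSpace ℝ (Fin d) → Ξ → ℝ) (σ : ℝ) : Prop :=
  ∀ x, ∫⁻ ξ, ‖stochGrad F ξ x - gradient (objective D F) x‖ₑ ^ 2 ∂D ≤ ENNReal.ofReal (σ ^ 2)

/-- Average `L`-smoothness: `𝔼_ξ ‖∇f_ξ(x) - ∇f_ξ(y)‖² ≤ L² ‖x - y‖²` for all `x`, `y`. -/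
def AverageSmooth {d : ℕ} {Ξ : Type} [MeasurableSpace Ξ] (D : Measure Ξ)
    (F : EuclideanSpace ℝ (Fin d) → Ξ → ℝ) (L : ℝ) : Prop :=
  ∀ x y, ∫⁻ ξ, ‖stochGrad F ξ x - stochGrad F ξ y‖ₑ ^ 2 ∂D ≤
    ENNReal.ofReal (L ^ 2 * ‖x - y‖ ^ 2)

/-- `Lin{x⁰, …, x^{t-1}, ∇f_{i_0}(x⁰), …, ∇f_{i_{t-1}}(x^{t-1})}`. The starting point is listed
separately only so that it is also there for `t = 0`. -/
def historySpan {d : ℕ} {Ξ : Type} (F : EuclideanSpace ℝ (Fin d) → Ξ → ℝ)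
    (x : ℕ → EuclideanSpace ℝ (Fin d)) (i : ℕ → Ξ) (t : ℕ) :
    Submodule ℝ (EuclideanSpace ℝ (Fin d)) :=
  Submodule.span ℝ ({x 0} ∪ {v | ∃ s < t, v = x s} ∪ {v | ∃ s < t, v = stochGrad F (i s) (x s)})

/-- An execution of a (randomized) linear-span first-order algorithm with starting point `x₀` on the
problem with individual functions `F(·, ξ)`, over the probability space `(Ω, P)` that carries all
its randomness. At step `t` the stochastic gradient of the individual function `index t` is computed
at `point t`. The algorithm computes `numGrad` stochastic gradients (a possibly random number) and
then returns `output`, which lies in the span of what has been seen. Apart from the span condition,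
nothing restricts how points, indices, stopping and output are selected; in particular indices may
be sampled from the law of the problem, or picked in any other way. -/
structure LinearSpanRun {d : ℕ} {Ξ : Type} [MeasurableSpace Ξ]
    (F : EuclideanSpace ℝ (Fin d) → Ξ → ℝ) (x₀ : EuclideanSpace ℝ (Fin d))
    {Ω : Type*} [MeasurableSpace Ω] (P : Measure Ω) where
  point : ℕ → Ω → EuclideanSpace ℝ (Fin d)
  index : ℕ → Ω → Ξ
  numGrad : Ω → ℕ
  output : Ω → EuclideanSpace ℝ (Fin d)
  measurable_point : ∀ t, Measurable (point t)
  measurable_index : ∀ t, Measurable (index t)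
  measurable_numGrad : Measurable numGrad
  measurable_output : Measurable output
  point_zero : ∀ᵐ ω ∂P, point 0 ω = x₀
  point_mem : ∀ t, 1 ≤ t → ∀ᵐ ω ∂P,
    point t ω ∈ historySpan F (fun s => point s ω) (fun s => index s ω) t
  output_mem : ∀ᵐ ω ∂P,
    output ω ∈ historySpan F (fun s => point s ω) (fun s => index s ω) (numGrad ω)

/-- The run returns an `ε`-approximate solution: `𝔼 ‖∇f(x̂)‖ ≤ ε`. -/
def LinearSpanRun.FindsApproxSolution {d : ℕ} {Ξ : Type} [MeasurableSpace Ξ]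
    {F : EuclideanSpace ℝ (Fin d) → Ξ → ℝ} {x₀ : EuclideanSpace ℝ (Fin d)}
    {Ω : Type*} [MeasurableSpace Ω] {P : Measure Ω} (R : LinearSpanRun F x₀ P)
    (D : Measure Ξ) (ε : ℝ) : Prop :=
  ∫⁻ ω, ‖gradient (objective D F) (R.output ω)‖ₑ ∂P ≤ ENNReal.ofReal ε

/-- The expected number of stochastic gradient computations of the run. -/
def LinearSpanRun.gradComplexity {d : ℕ} {Ξ : Type} [MeasurableSpace Ξ]
    {F : EuclideanSpace ℝ (Fin d) → Ξ → ℝ} {x₀ : EuclideanSpace ℝ (Fin d)}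
    {Ω : Type*} [MeasurableSpace Ω] {P : Measure Ω} (R : LinearSpanRun F x₀ P) : ℝ≥0∞ :=
  ∫⁻ ω, (R.numGrad ω : ℝ≥0∞) ∂P

/-- `b = min{σ²/ε², n}`, where `n` may be infinite. -/
def minBatch (σ ε : ℝ) (n : ℕ∞) : ℝ :=
  (min (ENNReal.ofReal (σ ^ 2 / ε ^ 2)) (n : ℝ≥0∞)).toReal

end

/-!
The index set is split into `m` groups of comparable probability, with `m` comparable to
`min {σ ^ 2 / ε ^ 2, n}`, and a point consists of `T` blocks of `m` coordinates, one coordinate per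
group and block. The mean function `chain` rewards increasing a coordinate of block `k`, but only
once the *gate* of that block has opened, which needs most coordinates of block `k - 1` to be
marked (close to `1` or larger). As long as some block is not unlocked, the gradient is at least of
order `1 / √m` (`le_norm_chainGrad`), while the initial gap is of order `T`.

The individual function of a group `j` differs from the mean by a multiple of a `noise j` that
depends on `j`, arranged so that within the current block the gradient of group `j` shows only
the coordinate `j`: the average noise cancels the reward in the mean exactly
(`chainGrad_add_mem`). A linear-span method therefore learns at most one coordinate per query, and
needs about `m / 2` queries before block `k` can unlock block `k + 1` (`hidesGradient_chain`).
By Markov's inequality, `T m / 2` queries are needed with probability at least `1 / 2`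
(`LinearSpanRun.le_gradComplexity`).

The number of blocks must not enter the variance and the mean squared smoothness. For this the noise
of block `k` is switched off not only while its gate is closed but also once block `k` or later
blocks are largely marked, so that at each point only one block, the `Active` one, carries
noise. The switch depends on all later blocks at once; it is still smooth on the scale of a single
block because marks are squares of Lipschitz functions, so the square root of their sum is Lipschitz
with a constant independent of the number of coordinates (`abs_sqrt_coordAvg_mark_sub_le`).

Scaling domain and values turns the variance bound into a bound for `m ε ^ 2 / σ ^ 2`, and
smoothness and gap into a bound for `T` of order `Δ₀ L / (ε ^ 2 √m)`; hence `T m` is of order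
`Δ₀ L √m / ε ^ 2` (`hasHardProblem_chain`). If this does not leave room for a single block, the term
`m` dominates, and a quadratic with linear noise in each coordinate requires `m / 2` queries
(`hasHardProblem_quadratic`). Arbitrary starting points are handled by embedding the model
isometrically into the orthogonal complement of `x₀`
(`exists_stochasticProblem_of_noiseModel`).
-/

/-! ### Gradient calculus -/

section GradientCalculus

variable {E : Type*} [NormedAddCommGroup E] [InnerProductSpace ℝ E] [CompleteSpace E]

theorem HasGradientAt.add {f g : E → ℝ} {f' g' x : E} (hf : HasGradientAt f f' x)
    (hg : HasGradientAt g g' x) : HasGradientAt (fun y => f y + g y) (f' + g') x := by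
  rw [hasGradientAt_iff_hasFDerivAt, map_add]
  exact hf.hasFDerivAt.add hg.hasFDerivAt

theorem HasGradientAt.sub {f g : E → ℝ} {f' g' x : E} (hf : HasGradientAt f f' x)
    (hg : HasGradientAt g g' x) : HasGradientAt (fun y => f y - g y) (f' - g') x := by
  rw [hasGradientAt_iff_hasFDerivAt, map_sub]
  exact hf.hasFDerivAt.sub hg.hasFDerivAt

theorem HasGradientAt.const_mul {f : E → ℝ} {f' x : E} (c : ℝ) (hf : HasGradientAt f f' x) :
    HasGradientAt (fun y => c * f y) (c • f') x := by
  rw [hasGradientAt_iff_hasFDerivAt, map_smul]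
  exact hf.hasFDerivAt.const_mul c

theorem HasGradientAt.mul {f g : E → ℝ} {f' g' x : E} (hf : HasGradientAt f f' x)
    (hg : HasGradientAt g g' x) :
    HasGradientAt (fun y => f y * g y) (f x • g' + g x • f') x := by
  rw [hasGradientAt_iff_hasFDerivAt, map_add, map_smul, map_smul]
  exact hf.hasFDerivAt.mul hg.hasFDerivAt

theorem HasGradientAt.sum {α : Type*} {s : Finset α} {f : α → E → ℝ} {f' : α → E} {x : E}
    (hf : ∀ i ∈ s, HasGradientAt (f i) (f' i) x) :
    HasGradientAt (fun y => ∑ i ∈ s, f i y) (∑ i ∈ s, f' i) x := by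
  rw [hasGradientAt_iff_hasFDerivAt, map_sum]
  exact HasFDerivAt.fun_sum fun i hi => (hf i hi).hasFDerivAt

theorem HasDerivAt.comp_hasGradientAt {φ : ℝ → ℝ} {φ' : ℝ} {f : E → ℝ} {f' x : E}
    (hφ : HasDerivAt φ φ' (f x)) (hf : HasGradientAt f f' x) :
    HasGradientAt (fun y => φ (f y)) (φ' • f') x := by
  rw [hasGradientAt_iff_hasFDerivAt, map_smul]
  exact hφ.comp_hasFDerivAt x hf.hasFDerivAt

/-- Precomposition with the adjoint of `J` carries gradients through `J`. -/
theorem HasGradientAt.comp_adjoint {E' : Type*} [NormedAddCommGroup E'] [InnerProductSpace ℝ E']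
    [CompleteSpace E'] {f : E → ℝ} {f' : E} {x : E'} (J : E →L[ℝ] E')
    (hf : HasGradientAt f f' (J.adjoint x)) :
    HasGradientAt (fun y => f (J.adjoint y)) (J f') x := by
  have key : InnerProductSpace.toDual ℝ E' (J f') =
      (InnerProductSpace.toDual ℝ E f').comp J.adjoint := by
    ext y
    simp [ContinuousLinearMap.adjoint_inner_right]
  rw [hasGradientAt_iff_hasFDerivAt, key]
  exact hf.hasFDerivAt.comp x J.adjoint.hasFDerivAt

end GradientCalculus

/-! ### From invariants of the history span to expected complexity -/

/-- If the invariant `Inv t V` survives every query at a point of `V`, then after `t` queries the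
whole history lies in a subspace `V` with `Inv t V`. -/
theorem exists_invariant_historySpan {d : ℕ} {Ξ : Type} {F : EuclideanSpace ℝ (Fin d) → Ξ → ℝ}
    {x₀ : EuclideanSpace ℝ (Fin d)} (Inv : ℕ → Submodule ℝ (EuclideanSpace ℝ (Fin d)) → Prop)
    {V₀ : Submodule ℝ (EuclideanSpace ℝ (Fin d))} (h0 : Inv 0 V₀) (hx₀ : x₀ ∈ V₀)
    (hstep : ∀ t V, Inv t V → ∀ x ∈ V, ∀ ξ, ∃ V', V ≤ V' ∧ Inv (t + 1) V' ∧ stochGrad F ξ x ∈ V')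
    {x : ℕ → EuclideanSpace ℝ (Fin d)} {i : ℕ → Ξ} (hx0 : x 0 = x₀)
    (hx : ∀ t, 1 ≤ t → x t ∈ historySpan F x i t) (t : ℕ) :
    ∃ V, Inv t V ∧ historySpan F x i t ≤ V := by
  induction t with
  | zero =>
    refine ⟨V₀, h0, ?_⟩
    rw [historySpan, Submodule.span_le]
    rintro v ((hv | ⟨s, hs, -⟩) | ⟨s, hs, -⟩)
    · rw [Set.mem_singleton_iff] at hv
      rw [hv, hx0]
      exact hx₀
    · omega
    · omega
  | succ t ih =>
    obtain ⟨V, hV, hle⟩ := ih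
    have hx0V : x 0 ∈ V :=
      hle (Submodule.subset_span (Or.inl (Or.inl rfl)))
    have hxt : x t ∈ V := by
      rcases Nat.eq_zero_or_pos t with rfl | ht
      · exact hx0V
      · exact hle (hx t ht)
    obtain ⟨V', hVV', hV', hg⟩ := hstep t V hV (x t) hxt (i t)
    refine ⟨V', hV', ?_⟩
    rw [historySpan, Submodule.span_le]
    rintro v ((hv | ⟨s, hs, rfl⟩) | ⟨s, hs, rfl⟩)
    · rw [Set.mem_singleton_iff] at hv
      rw [hv]
      exact hVV' hx0V
    · rcases Nat.lt_succ_iff_lt_or_eq.mp hs with hs | rfl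
      · exact hVV' (hle (Submodule.subset_span (Or.inl (Or.inr ⟨s, hs, rfl⟩))))
      · exact hVV' hxt
    · rcases Nat.lt_succ_iff_lt_or_eq.mp hs with hs | rfl
      · exact hVV' (hle (Submodule.subset_span (Or.inr ⟨s, hs, rfl⟩)))
      · exact hg

/-- If the gradient has norm at least `2 ε` on every subspace that fewer than `K` queries can
reach, then by Markov's inequality an `ε`-approximate solution costs at least `K` queries with
probability `1/2`. -/
theorem LinearSpanRun.le_gradComplexity {d : ℕ} {Ξ : Type} [MeasurableSpace Ξ]
    {F : EuclideanSpace ℝ (Fin d) → Ξ → ℝ} {x₀ : EuclideanSpace ℝ (Fin d)}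
    {Ω : Type*} [MeasurableSpace Ω] {P : Measure Ω} [IsProbabilityMeasure P]
    (R : LinearSpanRun F x₀ P) {D : Measure Ξ} {ε : ℝ} (hε : 0 < ε)
    (hR : R.FindsApproxSolution D ε)
    (Inv : ℕ → Submodule ℝ (EuclideanSpace ℝ (Fin d)) → Prop)
    {V₀ : Submodule ℝ (EuclideanSpace ℝ (Fin d))} (h0 : Inv 0 V₀) (hx₀ : x₀ ∈ V₀)
    (hstep : ∀ t V, Inv t V → ∀ x ∈ V, ∀ ξ, ∃ V', V ≤ V' ∧ Inv (t + 1) V' ∧ stochGrad F ξ x ∈ V')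
    (K : ℕ)
    (hK : ∀ t < K, ∀ V, Inv t V → ∀ x ∈ V, 2 * ε ≤ ‖gradient (objective D F) x‖) :
    ENNReal.ofReal (K / 2) ≤ R.gradComplexity := by
  have hpath : ∀ᵐ ω ∂P, R.numGrad ω < K →
      ENNReal.ofReal (2 * ε) ≤ ‖gradient (objective D F) (R.output ω)‖ₑ := by
    have hmem : ∀ᵐ ω ∂P, ∀ t, 1 ≤ t →
        R.point t ω ∈ historySpan F (fun s => R.point s ω) (fun s => R.index s ω) t := by
      rw [ae_all_iff]
      intro t
      by_cases ht : 1 ≤ t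
      · filter_upwards [R.point_mem t ht] with ω hω _ using hω
      · exact Filter.Eventually.of_forall fun ω h => absurd h ht
    filter_upwards [R.point_zero, hmem, R.output_mem] with ω h1 h2 h3 hlt
    obtain ⟨V, hV, hle⟩ := exists_invariant_historySpan Inv h0 hx₀ hstep h1 h2 (R.numGrad ω)
    rw [← ofReal_norm]
    exact ENNReal.ofReal_le_ofReal (hK _ hlt V hV _ (hle h3))
  set A : Set Ω := {ω | R.numGrad ω < K} with hA
  have hAm : MeasurableSet A := R.measurable_numGrad measurableSet_Iio
  have h1 : ENNReal.ofReal (2 * ε) * P A ≤ ENNReal.ofReal ε := by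
    calc ENNReal.ofReal (2 * ε) * P A
        = ∫⁻ ω, A.indicator (fun _ => ENNReal.ofReal (2 * ε)) ω ∂P := by
          rw [lintegral_indicator_const hAm]
      _ ≤ ∫⁻ ω, ‖gradient (objective D F) (R.output ω)‖ₑ ∂P := by
          refine lintegral_mono_ae ?_
          filter_upwards [hpath] with ω hω
          by_cases h : ω ∈ A
          · rw [Set.indicator_of_mem h]
            exact hω h
          · rw [Set.indicator_of_notMem h]
            exact bot_le
      _ ≤ _ := hR
  have hPA : P.real A ≤ 1 / 2 := by
    have h2 := ENNReal.toReal_mono ENNReal.ofReal_ne_top h1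
    rw [ENNReal.toReal_mul, ENNReal.toReal_ofReal (by positivity),
      ENNReal.toReal_ofReal hε.le] at h2
    change 2 * ε * P.real A ≤ ε at h2
    by_contra! hc
    nlinarith
  have hPAc : 1 / 2 ≤ P.real Aᶜ := by
    rw [probReal_compl_eq_one_sub hAm]
    linarith
  calc ENNReal.ofReal (K / 2) ≤ ENNReal.ofReal (K * P.real Aᶜ) :=
        ENNReal.ofReal_le_ofReal (by
          have : (0 : ℝ) ≤ K := Nat.cast_nonneg K
          nlinarith)
    _ = K * P Aᶜ := by
        rw [ENNReal.ofReal_mul (Nat.cast_nonneg K), ENNReal.ofReal_natCast, ofReal_measureReal]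
    _ = ∫⁻ ω, Aᶜ.indicator (fun _ => (K : ℝ≥0∞)) ω ∂P := by
        rw [lintegral_indicator_const hAm.compl]
    _ ≤ R.gradComplexity := by
        refine lintegral_mono fun ω => ?_
        by_cases h : ω ∈ Aᶜ
        · rw [Set.indicator_of_mem h]
          have : K ≤ R.numGrad ω := by simpa [hA] using h
          exact Nat.cast_le.mpr this
        · rw [Set.indicator_of_notMem h]
          exact bot_le

/-! ### Sample laws with a prescribed number of groups -/

/-- Every admissible size `n ≥ m` has a sample law whose index set splits into `m` groups, each of
probability at least `1 / (2 m)`. -/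
theorem exists_isSampleLaw_partition (n : ℕ∞) (m : ℕ) (hm : 1 ≤ m) (hmn : (m : ℕ∞) ≤ n) :
    ∃ (Ξ : Type) (_ : MeasurableSpace Ξ) (D : Measure Ξ) (π : Ξ → Fin m),
      IsSampleLaw n D ∧ Measurable π ∧ ∀ j, 1 ≤ 2 * (m : ℝ) * D.real (π ⁻¹' {j}) := by
  have hprob : ∀ N : ℕ, 1 ≤ N → IsProbabilityMeasure
      ((N : ℝ≥0∞)⁻¹ • (Measure.count : Measure (Fin N))) := fun N hN => by
    constructor
    rw [Measure.smul_apply, Measure.count_univ, ENat.card_eq_coe_fintype_card, Fintype.card_fin,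
      smul_eq_mul]
    exact ENNReal.inv_mul_cancel (by simp; omega) (by simp)
  induction n using ENat.recTopCoe with
  | top =>
    have := hprob m hm
    have : IsProbabilityMeasure (volume.restrict (Set.Icc (0 : ℝ) 1)) := ⟨by simp⟩
    have : Nonempty (Fin m) := ⟨⟨0, hm⟩⟩
    -- the product of the uniform law on the groups with the uniform law on `[0, 1]` has no atoms
    refine ⟨Fin m × ℝ, inferInstance, ((m : ℝ≥0∞)⁻¹ • (Measure.count : Measure (Fin m))).prod
      (volume.restrict (Set.Icc (0 : ℝ) 1)), Prod.fst, ⟨inferInstance, ?_, ?_⟩, measurable_fst, ?_⟩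
    · exact ENat.card_eq_top_of_infinite
    · rintro ⟨i, x⟩
      rw [← Set.singleton_prod_singleton, Measure.prod_prod]
      simp
    · intro j
      have h : (Prod.fst ⁻¹' {j} : Set (Fin m × ℝ)) = {j} ×ˢ Set.univ := by
        ext; simp
      have hm' : (m : ℝ) ≠ 0 := by positivity
      rw [h, measureReal_def, Measure.prod_prod]
      simp
      field_simp
      norm_num
  | coe N =>
    have hmN : m ≤ N := by exact_mod_cast hmn
    -- The groups are the residue classes modulo `m`, each with at least `⌊N / m⌋` elements.
    refine ⟨Fin N, inferInstance, (N : ℝ≥0∞)⁻¹ • (Measure.count : Measure (Fin N)),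
      fun i => ⟨i % m, Nat.mod_lt _ hm⟩, ⟨hprob N (hm.trans hmN), ?_, ?_⟩,
      measurable_of_countable _, ?_⟩
    · simp [ENat.card_eq_coe_fintype_card]
    · intro i
      simp
    · intro j
      set A : Set (Fin N) := (fun i : Fin N => (⟨i % m, Nat.mod_lt _ hm⟩ : Fin m)) ⁻¹' {j} with hA
      have hcard : N / m ≤ A.ncard := by
        have hlt : ∀ q < N / m, j + q * m < N := fun q hq => by
          have h1 : (q + 1) * m ≤ N / m * m := Nat.mul_le_mul_right m hq
          have h2 := Nat.div_mul_le_self N m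
          have h3 := j.2
          rw [add_mul, one_mul] at h1
          omega
        have h := Set.ncard_le_ncard_of_injOn (s := (Finset.range (N / m) : Set ℕ)) (t := A)
          (fun q => if hq : q < N / m then ⟨j + q * m, hlt q hq⟩ else ⟨0, by omega⟩) ?_ ?_
          (Set.toFinite A)
        · rwa [Set.ncard_coe_finset, Finset.card_range] at h
        · intro q hq
          have hq : q < N / m := by simpa using hq
          simp [hA, hq, Nat.mod_eq_of_lt j.2]
        · intro q hq q' hq' he
          have hq : q < N / m := by simpa using hq
          have hq' : q' < N / m := by simpa using hq'
          simp only [hq, hq', dif_pos, Fin.mk.injEq] at he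
          exact Nat.eq_of_mul_eq_mul_right hm (by omega)
      have hreal : ((N : ℝ≥0∞)⁻¹ • (Measure.count : Measure (Fin N))).real A = A.ncard / N := by
        rw [measureReal_def, Measure.smul_apply, Measure.count_apply A.toFinite.measurableSet,
          smul_eq_mul, ENNReal.toReal_mul, ← Set.Finite.cast_ncard_eq A.toFinite,
          ENat.toENNReal_coe, ENNReal.toReal_natCast, ENNReal.toReal_inv, ENNReal.toReal_natCast]
        ring
      have hN : (0 : ℝ) < N := by exact_mod_cast (hm.trans hmN)
      rw [hreal, ← mul_div_assoc, le_div_iff₀ hN, one_mul]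
      have h1 : N ≤ 2 * m * A.ncard := by
        have h2 : N < m * (N / m) + m := by
          have := Nat.div_add_mod N m
          have := Nat.mod_lt N hm
          omega
        have h3 : 1 ≤ N / m := (Nat.one_le_div_iff hm).mpr hmN
        nlinarith
      exact_mod_cast h1

section Partition

variable {Ξ : Type} [MeasurableSpace Ξ] {D : Measure Ξ} [IsProbabilityMeasure D] {m : ℕ}
  {π : Ξ → Fin m}

theorem integrable_comp_partition (hπ : Measurable π) {X : Type*} [NormedAddCommGroup X]
    (φ : Fin m → X) : Integrable (fun ξ => φ (π ξ)) D :=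
  (Integrable.of_finite (μ := D.map π) (f := φ)).comp_measurable hπ

theorem integral_comp_partition (hπ : Measurable π) {X : Type*} [NormedAddCommGroup X]
    [NormedSpace ℝ X] [CompleteSpace X] (φ : Fin m → X) :
    ∫ ξ, φ (π ξ) ∂D = ∑ j, D.real (π ⁻¹' {j}) • φ j := by
  rw [← integral_map hπ.aemeasurable Integrable.of_finite.aestronglyMeasurable,
    integral_fintype Integrable.of_finite]
  simp_rw [map_measureReal_apply hπ (measurableSet_singleton _)]

theorem lintegral_enorm_sq_comp_partition (hπ : Measurable π) {X : Type*} [NormedAddCommGroup X]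
    (φ : Fin m → X) :
    ∫⁻ ξ, ‖φ (π ξ)‖ₑ ^ 2 ∂D = ENNReal.ofReal (∑ j, D.real (π ⁻¹' {j}) * ‖φ j‖ ^ 2) := by
  rw [← lintegral_map (f := fun j => ‖φ j‖ₑ ^ 2) (measurable_of_countable _) hπ,
    lintegral_fintype, ENNReal.ofReal_sum_of_nonneg (fun j _ => by positivity)]
  refine Finset.sum_congr rfl fun j _ => ?_
  rw [Measure.map_apply hπ (measurableSet_singleton _), ENNReal.ofReal_mul (by positivity),
    ofReal_measureReal, ENNReal.ofReal_pow (norm_nonneg _), ofReal_norm, mul_comm]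

theorem sum_measureReal_partition (hπ : Measurable π) : ∑ j, D.real (π ⁻¹' {j}) = 1 := by
  have h := integral_comp_partition (D := D) hπ (fun _ => (1 : ℝ))
  simpa using h.symm

end Partition

/-! ### Embedding orthogonally to the starting point -/

/-- In one dimension more than `|ι|`, Euclidean space on `ι` embeds isometrically into the
orthogonal complement of any given vector. -/
theorem exists_linearIsometry_adjoint_eq_zero {ι : Type*} [Fintype ι]
    (x₀ : EuclideanSpace ℝ (Fin (Fintype.card ι + 1))) :
    ∃ J : EuclideanSpace ℝ ι →ₗᵢ[ℝ] EuclideanSpace ℝ (Fin (Fintype.card ι + 1)),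
      J.toContinuousLinearMap.adjoint x₀ = 0 := by
  classical
  set K := (Submodule.span ℝ {x₀})ᗮ with hK
  have hdim : Fintype.card ι ≤ Module.finrank ℝ K := by
    have h1 := Submodule.finrank_add_finrank_orthogonal (Submodule.span ℝ {x₀})
    have h2 : Module.finrank ℝ (Submodule.span ℝ {x₀}) ≤ 1 := by
      simpa using finrank_span_le_card (R := ℝ) {x₀}
    rw [← hK, finrank_euclideanSpace_fin] at h1
    omega
  let e : ι ↪ Fin (Module.finrank ℝ K) :=
    (Fintype.equivFin ι).toEmbedding.trans (Fin.castLEEmb hdim)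
  let w : ι → EuclideanSpace ℝ (Fin (Fintype.card ι + 1)) :=
    fun i => (stdOrthonormalBasis ℝ K (e i) : EuclideanSpace ℝ (Fin (Fintype.card ι + 1)))
  have hw : Orthonormal ℝ w :=
    ((stdOrthonormalBasis ℝ K).orthonormal.comp e e.injective).comp_linearIsometry K.subtypeₗᵢ
  let b := (EuclideanSpace.basisFun ι ℝ)
  let f := b.toBasis.constr ℝ w
  have hb : Orthonormal ℝ b.toBasis := by
    rw [b.coe_toBasis]
    exact b.orthonormal
  have hf : f ∘ b.toBasis = w := by
    funext i
    exact b.toBasis.constr_basis ℝ w i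
  have hf' : Orthonormal ℝ (f ∘ b.toBasis) := by
    rw [hf]
    exact hw
  refine ⟨f.isometryOfOrthonormal hb hf', ?_⟩
  have hmem : ∀ y, f y ∈ K := fun y => by
    rw [← b.toBasis.sum_repr y, map_sum]
    refine Submodule.sum_mem _ fun i _ => ?_
    rw [map_smul, show f (b.toBasis i) = w i from congrFun hf i]
    exact K.smul_mem _ (stdOrthonormalBasis ℝ K (e i)).2
  refine ext_inner_right ℝ fun y => ?_
  rw [ContinuousLinearMap.adjoint_inner_left, inner_zero_left]
  exact hmem y x₀ (Submodule.mem_span_singleton_self x₀)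

/-! ### Weighted mean and variance -/

/-- The bias-variance decomposition, with the variance bounded by the second moment. -/
theorem sum_weight_norm_sub_sq_le {X : Type*} [NormedAddCommGroup X] [InnerProductSpace ℝ X]
    {m : ℕ} (p : Fin m → ℝ) (hp : ∑ j, p j = 1) (a : X) (x : Fin m → X) :
    ∑ j, p j * ‖a - (x j - ∑ i, p i • x i)‖ ^ 2 ≤ ‖a‖ ^ 2 + ∑ j, p j * ‖x j‖ ^ 2 := by
  set c := ∑ i, p i • x i with hc
  have h1 : ∀ j, p j * ‖a - (x j - c)‖ ^ 2 =
      p j * ‖a + c‖ ^ 2 - 2 * inner ℝ (a + c) (p j • x j) + p j * ‖x j‖ ^ 2 := fun j => by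
    rw [show a - (x j - c) = (a + c) - x j by abel, norm_sub_sq_real, inner_smul_right]
    ring
  simp_rw [h1]
  rw [Finset.sum_add_distrib, Finset.sum_sub_distrib, ← Finset.sum_mul, hp, ← Finset.mul_sum,
    ← inner_sum, ← hc, norm_add_sq_real, inner_add_left, real_inner_self_eq_norm_sq]
  nlinarith [sq_nonneg ‖c‖]

/-! ### Transferring a finite-dimensional instance -/

universe u

/-- In some dimension, for every starting point, there is a stochastic problem of size `n` with
average smoothness `L`, initial gap `Δ₀` and variance at most `σ ^ 2`, on which every run that
returns an `ε`-approximate solution computes at least `B` stochastic gradients in expectation. -/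
def HasHardProblem (n : ℕ∞) (L Δ₀ σ ε B : ℝ) : Prop :=
  ∃ d : ℕ, ∀ x₀ : EuclideanSpace ℝ (Fin d),
    ∃ (Ξ : Type) (_ : MeasurableSpace Ξ) (D : Measure Ξ)
      (F : EuclideanSpace ℝ (Fin d) → Ξ → ℝ),
      IsSampleLaw n D ∧ IsStochasticProblem D F ∧
      BoundedVariance D F σ ∧ AverageSmooth D F L ∧
      (∃ fstar : ℝ, IsLeast (Set.range (objective D F)) fstar ∧
        objective D F x₀ - fstar = Δ₀) ∧
      ∀ (Ω : Type u) [MeasurableSpace Ω] (P : Measure Ω) [IsProbabilityMeasure P]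
        (R : LinearSpanRun F x₀ P), R.FindsApproxSolution D ε →
        ENNReal.ofReal B ≤ R.gradComplexity

theorem HasHardProblem.mono {n : ℕ∞} {L Δ₀ σ ε B B' : ℝ} (h : HasHardProblem.{u} n L Δ₀ σ ε B)
    (hB : B' ≤ B) : HasHardProblem.{u} n L Δ₀ σ ε B' := by
  obtain ⟨d, hd⟩ := h
  refine ⟨d, fun x₀ => ?_⟩
  obtain ⟨Ξ, mΞ, D, F, h1, h2, h3, h4, h5, h6⟩ := hd x₀
  exact ⟨Ξ, mΞ, D, F, h1, h2, h3, h4, h5, fun Ω _ P _ R hR =>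
    (ENNReal.ofReal_le_ofReal hB).trans (h6 Ω P R hR)⟩

/-- A mean function `h` and `m` noise functions `M j`, with gradients `Gh` and `Q j`, from which
the individual functions `h - (α j • M j - (1 / m) ∑ i, M i)` are formed; here `α j ≤ 2` is the
factor `1 / (m p j)` that makes the noise average out when group `j` has probability `p j`.
The constants bound the squared Lipschitz constant of `Gh`, the mean squared Lipschitz constant of
the `Q j`, and their second moment. -/
structure IsNoiseModel {ι : Type*} [Fintype ι] {m : ℕ} (h : EuclideanSpace ℝ ι → ℝ)
    (Gh : EuclideanSpace ℝ ι → EuclideanSpace ℝ ι) (M : Fin m → EuclideanSpace ℝ ι → ℝ)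
    (Q : Fin m → EuclideanSpace ℝ ι → EuclideanSpace ℝ ι) (ℓ₁ ℓ₂ v : ℝ) : Prop where
  grad_mean : ∀ y, HasGradientAt h (Gh y) y
  grad_noise : ∀ j y, HasGradientAt (M j) (Q j y) y
  smooth_mean : ∀ y z, ‖Gh y - Gh z‖ ^ 2 ≤ ℓ₁ * ‖y - z‖ ^ 2
  smooth_noise : ∀ y z, (∑ j, ‖Q j y - Q j z‖ ^ 2) / m ≤ ℓ₂ * ‖y - z‖ ^ 2
  second_moment : ∀ y, (∑ j, ‖Q j y‖ ^ 2) / m ≤ v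

/-- The information hidden by a noise model: `Inv t V` says that `V` may contain everything known
after `t` queries, starting from no knowledge. A query at a point of `V` to component `j` reveals
`Gh y + (1 / m) ∑ i, Q i y` and a multiple of `Q j y`. Points reachable with fewer than `K` queries
have gradient norm at least `γ`. -/
structure HidesGradient {ι : Type*} [Fintype ι] {m : ℕ}
    (Gh : EuclideanSpace ℝ ι → EuclideanSpace ℝ ι)
    (Q : Fin m → EuclideanSpace ℝ ι → EuclideanSpace ℝ ι)
    (Inv : ℕ → Submodule ℝ (EuclideanSpace ℝ ι) → Prop) (K : ℕ) (γ : ℝ) : Prop where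
  start : ∃ V, Inv 0 V
  common_mem : ∀ t V, Inv t V → ∀ y ∈ V, Gh y + (m : ℝ)⁻¹ • ∑ i, Q i y ∈ V
  step : ∀ t V, Inv t V → ∀ y ∈ V, ∀ j, ∃ V', V ≤ V' ∧ Inv (t + 1) V' ∧ Q j y ∈ V'
  le_norm : ∀ t < K, ∀ V, Inv t V → ∀ y ∈ V, γ ≤ ‖Gh y‖

set_option maxHeartbeats 1000000 in
/-- A noise model with hidden gradients becomes, after rescaling the domain by `s` and the values
by `μ` and embedding it orthogonally to `x₀`, a stochastic problem of size `n` on which every run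
that returns an `ε`-approximate solution needs `K / 2` gradients in expectation. -/
theorem exists_stochasticProblem_of_noiseModel {ι : Type*} [Fintype ι] {m : ℕ} (hm : 1 ≤ m)
    {n : ℕ∞} (hmn : (m : ℕ∞) ≤ n) {h : EuclideanSpace ℝ ι → ℝ}
    {Gh : EuclideanSpace ℝ ι → EuclideanSpace ℝ ι} {M : Fin m → EuclideanSpace ℝ ι → ℝ}
    {Q : Fin m → EuclideanSpace ℝ ι → EuclideanSpace ℝ ι} {ℓ₁ ℓ₂ v : ℝ}
    (hmod : IsNoiseModel h Gh M Q ℓ₁ ℓ₂ v)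
    {Inv : ℕ → Submodule ℝ (EuclideanSpace ℝ ι) → Prop} {K : ℕ} {γ : ℝ}
    (hid : HidesGradient Gh Q Inv K γ)
    {μ s σ L Δ₀ ε : ℝ} (hμ : 0 < μ) (hs : 0 < s) (hε : 0 < ε)
    (hvar : m = 1 ∨ (μ / s) ^ 2 * (2 * v) ≤ σ ^ 2)
    (hℓ : 0 ≤ ℓ₁ + 2 * ℓ₂)
    (hsmooth : (μ / s ^ 2) ^ 2 * (ℓ₁ + 2 * ℓ₂) ≤ L ^ 2)
    {y₁ : EuclideanSpace ℝ ι} (hmin : ∀ y, h y₁ ≤ h y) (hΔ : μ * (h 0 - h y₁) = Δ₀)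
    (hγ : 2 * ε ≤ μ / s * γ) :
    HasHardProblem.{u} n L Δ₀ σ ε (K / 2) := by
  refine ⟨Fintype.card ι + 1, fun x₀ => ?_⟩
  obtain ⟨Ξ, mΞ, D, π, hD, hπ, hp⟩ := exists_isSampleLaw_partition n m hm hmn
  obtain ⟨J, hJ⟩ := exists_linearIsometry_adjoint_eq_zero (ι := ι) x₀
  have hDp : IsProbabilityMeasure D := hD.1
  have hm0 : (0 : ℝ) < m := by exact_mod_cast hm
  set p : Fin m → ℝ := fun j => D.real (π ⁻¹' {j}) with hpdef
  have hp1 : ∑ j, p j = 1 := sum_measureReal_partition hπ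
  have hp0 : ∀ j, 0 < p j := fun j => by
    by_contra! hc
    have := hp j
    change 1 ≤ 2 * (m : ℝ) * p j at this
    nlinarith
  set α : Fin m → ℝ := fun j => (m * p j)⁻¹ with hα
  have hα0 : ∀ j, 0 < α j := fun j => inv_pos.mpr (mul_pos hm0 (hp0 j))
  have hα2 : ∀ j, α j ≤ 2 := fun j => by
    have := hp j
    change 1 ≤ 2 * (m : ℝ) * p j at this
    rw [hα]
    simp only
    rw [inv_le_comm₀ (mul_pos hm0 (hp0 j)) two_pos]
    linarith
  have hpα : ∀ j, p j * α j = (m : ℝ)⁻¹ := fun j => by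
    have := (hp0 j).ne'
    simp only [hα]
    field_simp
  -- `B` embeds and rescales; its adjoint reads the model coordinates `y` off a point.
  set B : EuclideanSpace ℝ ι →L[ℝ] EuclideanSpace ℝ (Fin (Fintype.card ι + 1)) :=
    s⁻¹ • J.toContinuousLinearMap with hB
  have hBnorm : ∀ v, ‖B v‖ = s⁻¹ * ‖v‖ := fun v => by
    simp [hB, norm_smul, abs_of_pos hs]
  have hBadj : ∀ v, ‖B.adjoint v‖ ≤ s⁻¹ * ‖v‖ := fun v => by
    have h1 : ‖B.adjoint‖ ≤ s⁻¹ := by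
      rw [LinearIsometryEquiv.norm_map]
      exact B.opNorm_le_bound (by positivity) fun v => (hBnorm v).le
    exact (B.adjoint.le_opNorm v).trans (by gcongr)
  have hBB : ∀ v, B.adjoint (B v) = (s⁻¹ * s⁻¹) • v := fun v => by
    have h1 : J.toContinuousLinearMap.adjoint (J.toContinuousLinearMap v) = v :=
      congrArg (fun T => T v) J.adjoint_comp_self
    simp only [hB, map_smulₛₗ, smul_apply, h1, smul_smul]
    simp
  have hBx₀ : B.adjoint x₀ = 0 := by
    simp [hB, hJ]
  -- the components of the model and their gradients
  set f : Fin m → EuclideanSpace ℝ ι → ℝ :=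
    fun j y => h y - (α j * M j y - (m : ℝ)⁻¹ * ∑ i, M i y) with hf
  set g : Fin m → EuclideanSpace ℝ ι → EuclideanSpace ℝ ι :=
    fun j y => Gh y - (α j • Q j y - (m : ℝ)⁻¹ • ∑ i, Q i y) with hg
  have hfg : ∀ j y, HasGradientAt (f j) (g j y) y := fun j y =>
    (hmod.grad_mean y).sub (((hmod.grad_noise j y).const_mul _).sub
      ((HasGradientAt.sum fun i _ => hmod.grad_noise i y).const_mul _))
  have hpf : ∀ y, ∑ j, p j * f j y = h y := fun y => by
    have h1 : ∀ j, p j * f j y = p j * (h y + (m : ℝ)⁻¹ * ∑ i, M i y) - (m : ℝ)⁻¹ * M j y :=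
      fun j => by rw [← hpα j]; simp only [hf]; rw [hpα j, ← hpα j]; ring
    simp_rw [h1]
    rw [Finset.sum_sub_distrib, ← Finset.sum_mul, hp1, ← Finset.mul_sum]
    ring
  have hmeanQ : ∀ y, ∑ i, p i • α i • Q i y = (m : ℝ)⁻¹ • ∑ i, Q i y := fun y => by
    simp_rw [smul_smul, hpα, Finset.smul_sum]
  have hpg : ∀ y, ∑ j, p j • g j y = Gh y := fun y => by
    simp only [hg, smul_sub]
    rw [Finset.sum_sub_distrib, Finset.sum_sub_distrib, hmeanQ, ← Finset.sum_smul,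
      ← Finset.sum_smul, hp1]
    simp
  have hmoment : ∀ w : Fin m → EuclideanSpace ℝ ι,
      ∑ j, p j * ‖α j • w j‖ ^ 2 ≤ 2 * ((∑ j, ‖w j‖ ^ 2) / m) := fun w => by
    rw [Finset.sum_div, Finset.mul_sum]
    refine Finset.sum_le_sum fun j _ => ?_
    rw [norm_smul, Real.norm_of_nonneg (hα0 j).le, mul_pow, sq (α j), ← mul_assoc, ← mul_assoc,
      hpα, div_eq_inv_mul, ← mul_assoc, mul_comm (m : ℝ)⁻¹]
    gcongr
    exact hα2 j
  set F : EuclideanSpace ℝ (Fin (Fintype.card ι + 1)) → Ξ → ℝ :=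
    fun x ξ => μ * f (π ξ) (B.adjoint x) with hF
  have hFg : ∀ ξ x, HasGradientAt (fun x => F x ξ) (μ • B (g (π ξ) (B.adjoint x))) x :=
    fun ξ x => ((hfg (π ξ) (B.adjoint x)).comp_adjoint B).const_mul μ
  have hsg : ∀ ξ x, stochGrad F ξ x = μ • B (g (π ξ) (B.adjoint x)) :=
    fun ξ x => (hFg ξ x).gradient
  have hobj : objective D F = fun x => μ * h (B.adjoint x) := by
    funext x
    rw [objective, integral_comp_partition hπ (fun j => μ * f j (B.adjoint x)), ← hpf,
      Finset.mul_sum]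
    exact Finset.sum_congr rfl fun j _ => by simp only [smul_eq_mul]; ring
  have hobjg : ∀ x, HasGradientAt (objective D F) (μ • B (Gh (B.adjoint x))) x := fun x => by
    rw [hobj]
    exact ((hmod.grad_mean (B.adjoint x)).comp_adjoint B).const_mul μ
  have hnorm : ∀ v, ‖μ • B v‖ = μ / s * ‖v‖ := fun v => by
    rw [norm_smul, hBnorm, Real.norm_of_nonneg hμ.le]
    ring
  refine ⟨Ξ, mΞ, D, F, hD, ⟨fun ξ x => (hFg ξ x).differentiableAt, fun x => ?_, fun x => ?_,
    fun x => ?_⟩, fun x => ?_, fun x y => ?_, ⟨μ * h y₁, ⟨⟨(s * s) • B y₁, ?_⟩, ?_⟩, ?_⟩, ?_⟩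
  · exact integrable_comp_partition hπ (fun j => μ * f j (B.adjoint x))
  · simp_rw [hsg]
    exact integrable_comp_partition hπ (fun j => μ • B (g j (B.adjoint x)))
  · have h1 : ∫ ξ, stochGrad F ξ x ∂D = μ • B (Gh (B.adjoint x)) := by
      simp_rw [hsg]
      rw [integral_comp_partition hπ (fun j => μ • B (g j (B.adjoint x))), ← hpg, map_sum,
        Finset.smul_sum]
      refine Finset.sum_congr rfl fun j _ => ?_
      exact (smul_comm (p j) μ _).trans (congrArg (μ • ·) (B.map_smul (p j) _).symm)
    rw [h1]
    exact hobjg x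
  · simp_rw [hsg, (hobjg x).gradient]
    rw [lintegral_enorm_sq_comp_partition hπ
      (fun j => μ • B (g j (B.adjoint x)) - μ • B (Gh (B.adjoint x)))]
    refine ENNReal.ofReal_le_ofReal ?_
    set y := B.adjoint x
    have h1 : ∀ j, ‖μ • B (g j y) - μ • B (Gh y)‖ ^ 2 =
        (μ / s) ^ 2 * ‖(0 : EuclideanSpace ℝ ι) - (α j • Q j y - ∑ i, p i • α i • Q i y)‖ ^ 2 :=
      fun j => by
        rw [← smul_sub, ← map_sub, hnorm, mul_pow, hmeanQ]
        congr 3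
        simp only [hg]
        abel
    simp_rw [h1]
    rcases hvar with rfl | hvar
    · -- a single component carries no noise
      have hp10 : p 0 = 1 := by simpa using hp1
      have hα10 : α 0 = 1 := by simp [hα, hp10]
      simp only [Fin.sum_univ_one, Fin.isValue, hp10, hα10]
      simp
      positivity
    · calc ∑ j, p j * ((μ / s) ^ 2 * ‖(0 : EuclideanSpace ℝ ι) -
            (α j • Q j y - ∑ i, p i • α i • Q i y)‖ ^ 2)
          = (μ / s) ^ 2 * ∑ j, p j * ‖(0 : EuclideanSpace ℝ ι) -
            (α j • Q j y - ∑ i, p i • α i • Q i y)‖ ^ 2 := by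
            rw [Finset.mul_sum]
            exact Finset.sum_congr rfl fun j _ => by ring
        _ ≤ (μ / s) ^ 2 * (2 * v) := by
            gcongr
            refine (sum_weight_norm_sub_sq_le p hp1 _ _).trans ?_
            rw [norm_zero, zero_pow two_ne_zero, zero_add]
            refine (hmoment _).trans ?_
            have := hmod.second_moment y
            linarith
        _ ≤ σ ^ 2 := hvar
  · simp_rw [hsg]
    rw [lintegral_enorm_sq_comp_partition hπ
      (fun j => μ • B (g j (B.adjoint x)) - μ • B (g j (B.adjoint y)))]
    refine ENNReal.ofReal_le_ofReal ?_
    have hadj : ‖B.adjoint x - B.adjoint y‖ ≤ s⁻¹ * ‖x - y‖ := by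
      rw [← map_sub]
      exact hBadj _
    set y' := B.adjoint x
    set z' := B.adjoint y
    have h1 : ∀ j, ‖μ • B (g j y') - μ • B (g j z')‖ ^ 2 = (μ / s) ^ 2 * ‖(Gh y' - Gh z') -
        (α j • (Q j y' - Q j z') - ∑ i, p i • α i • (Q i y' - Q i z'))‖ ^ 2 := fun j => by
      rw [← smul_sub, ← map_sub, hnorm, mul_pow]
      congr 3
      simp only [smul_sub, Finset.sum_sub_distrib, hmeanQ, hg]
      abel
    simp_rw [h1]
    calc ∑ j, p j * ((μ / s) ^ 2 * ‖(Gh y' - Gh z') -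
          (α j • (Q j y' - Q j z') - ∑ i, p i • α i • (Q i y' - Q i z'))‖ ^ 2)
        = (μ / s) ^ 2 * ∑ j, p j * ‖(Gh y' - Gh z') -
          (α j • (Q j y' - Q j z') - ∑ i, p i • α i • (Q i y' - Q i z'))‖ ^ 2 := by
          rw [Finset.mul_sum]
          exact Finset.sum_congr rfl fun j _ => by ring
      _ ≤ (μ / s) ^ 2 * ((ℓ₁ + 2 * ℓ₂) * ‖y' - z'‖ ^ 2) := by
          gcongr
          refine (sum_weight_norm_sub_sq_le p hp1 _ _).trans ?_
          have h2 := hmoment (fun j => Q j y' - Q j z')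
          have h3 := hmod.smooth_noise y' z'
          have h4 := hmod.smooth_mean y' z'
          linarith
      _ ≤ (μ / s) ^ 2 * ((ℓ₁ + 2 * ℓ₂) * (s⁻¹ * ‖x - y‖) ^ 2) := by
          gcongr
      _ = (μ / s ^ 2) ^ 2 * (ℓ₁ + 2 * ℓ₂) * ‖x - y‖ ^ 2 := by
          field_simp
      _ ≤ L ^ 2 * ‖x - y‖ ^ 2 := by gcongr
  · rw [hobj]
    simp only [map_smul, hBB, smul_smul]
    rw [show s * s * (s⁻¹ * s⁻¹) = 1 by field_simp, one_smul]
  · rintro _ ⟨x, rfl⟩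
    rw [hobj]
    exact mul_le_mul_of_nonneg_left (hmin _) hμ.le
  · rw [hobj]
    simp only [hBx₀]
    rw [← hΔ]
    ring
  · intro Ω _ P _ R hR
    obtain ⟨V₀, hV₀⟩ := hid.start
    refine R.le_gradComplexity hε hR
      (fun t V => ∃ W, Inv t W ∧ V = W.comap (B.adjoint : _ →ₗ[ℝ] EuclideanSpace ℝ ι))
      (V₀ := V₀.comap (B.adjoint : _ →ₗ[ℝ] EuclideanSpace ℝ ι)) ⟨V₀, hV₀, rfl⟩ ?_ ?_ K ?_
    · change B.adjoint x₀ ∈ V₀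
      rw [hBx₀]
      exact V₀.zero_mem
    · rintro t _ ⟨W, hW, rfl⟩ x hx ξ
      obtain ⟨W', hWW', hW', hQ⟩ := hid.step t W hW _ hx (π ξ)
      refine ⟨_, Submodule.comap_mono hWW', ⟨W', hW', rfl⟩, ?_⟩
      change B.adjoint _ ∈ W'
      rw [hsg, map_smul, hBB, smul_smul]
      refine W'.smul_mem _ ?_
      -- a stochastic gradient splits into the part common to all components and the revealing part
      have h1 : g (π ξ) (B.adjoint x) = (Gh (B.adjoint x) + (m : ℝ)⁻¹ • ∑ i, Q i (B.adjoint x)) -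
          α (π ξ) • Q (π ξ) (B.adjoint x) := by
        simp only [hg]
        abel
      rw [h1]
      exact W'.sub_mem (hWW' (hid.common_mem t W hW _ hx)) (W'.smul_mem _ hQ)
    · rintro t ht _ ⟨W, hW, rfl⟩ x hx
      rw [(hobjg x).gradient, hnorm]
      refine hγ.trans ?_
      gcongr
      exact hid.le_norm t ht W hW _ hx

noncomputable section

/-! ### One-dimensional profiles -/

theorem hasDerivAt_of_abs_sub_le_sq {f : ℝ → ℝ} {f' x C : ℝ}
    (h : ∀ t, |f t - f x - f' * (t - x)| ≤ C * (t - x) ^ 2) : HasDerivAt f f' x := by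
  rw [hasDerivAt_iff_isLittleO]
  refine Asymptotics.IsBigO.trans_isLittleO ?_ (Asymptotics.isLittleO_pow_sub_sub x one_lt_two)
  refine Asymptotics.IsBigO.of_bound C (Filter.Eventually.of_forall fun t => ?_)
  have h1 := h t
  simp only [smul_eq_mul, Real.norm_eq_abs, abs_pow, sq_abs]
  rwa [mul_comm (t - x) f']

/-- The cubic smoothstep: `0` for `t ≤ 0`, `1` for `t ≥ 1`, with Lipschitz derivative. -/
def smoothstep (t : ℝ) : ℝ := 3 * (max 0 (min t 1)) ^ 2 - 2 * (max 0 (min t 1)) ^ 3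

/-- The derivative of `smoothstep`. -/
def smoothstepDeriv (t : ℝ) : ℝ := 6 * max 0 (min t 1) * (1 - max 0 (min t 1))

theorem clamp_nonneg (t : ℝ) : 0 ≤ max 0 (min t 1) := le_max_left _ _

theorem clamp_le_one (t : ℝ) : max 0 (min t 1) ≤ 1 := max_le zero_le_one (min_le_right _ _)

theorem abs_clamp_sub_le (t x : ℝ) : |max 0 (min t 1) - max 0 (min x 1)| ≤ |t - x| := by
  rw [max_comm 0, max_comm 0]
  refine (abs_max_sub_max_le_abs _ _ _).trans ?_
  simpa using abs_min_sub_min_le_max t 1 x 1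

theorem hasDerivAt_smoothstep (x : ℝ) : HasDerivAt smoothstep (smoothstepDeriv x) x := by
  refine hasDerivAt_of_abs_sub_le_sq (C := 9) fun t => ?_
  have h0 := clamp_nonneg t
  have h1 := clamp_le_one t
  have h2 := clamp_nonneg x
  have h3 := clamp_le_one x
  have h4 := abs_clamp_sub_le t x
  -- Outside the clamping region the error of the linear part is itself quadratic.
  have h5 : |smoothstepDeriv x * ((max 0 (min t 1) - max 0 (min x 1)) - (t - x))| ≤
      6 * (t - x) ^ 2 := by
    unfold smoothstepDeriv
    rcases le_total x 0 with hx | hx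
    · have : max 0 (min x 1) = 0 := max_eq_left ((min_le_left _ _).trans hx)
      rw [this]
      simp
      positivity
    rcases le_total 1 x with hx' | hx'
    · have : max 0 (min x 1) = 1 := by
        rw [min_eq_right hx']
        simp
      rw [this]
      simp
      positivity
    have hcx : max 0 (min x 1) = x := by
      rw [min_eq_left hx', max_eq_right hx]
    rw [hcx]
    rcases le_total t 0 with ht | ht
    · have : max 0 (min t 1) = 0 := max_eq_left ((min_le_left _ _).trans ht)
      rw [this, abs_le]
      constructor
      · nlinarith [mul_nonneg hx (sub_nonneg.mpr hx'), mul_nonneg hx (neg_nonneg.mpr ht),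
          mul_nonneg (mul_nonneg hx (sub_nonneg.mpr hx')) (neg_nonneg.mpr ht)]
      · nlinarith [mul_nonneg hx (neg_nonneg.mpr ht),
          mul_nonneg (mul_nonneg hx hx) (neg_nonneg.mpr ht), sq_nonneg t, sq_nonneg x]
    rcases le_total 1 t with ht' | ht'
    · have : max 0 (min t 1) = 1 := by
        rw [min_eq_right ht']
        simp
      rw [this, abs_le]
      have e1 := mul_nonneg (sub_nonneg.mpr hx') (sub_nonneg.mpr ht')
      constructor
      · nlinarith [mul_nonneg (sub_nonneg.mpr hx') e1, sq_nonneg (t - 1), sq_nonneg (1 - x)]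
      · nlinarith [mul_nonneg hx e1]
    · have : max 0 (min t 1) = t := by
        rw [min_eq_left ht', max_eq_right ht]
      rw [this]
      simp
      positivity
  have h6 : |smoothstep t - smoothstep x -
      smoothstepDeriv x * (max 0 (min t 1) - max 0 (min x 1))| ≤ 3 * (t - x) ^ 2 := by
    unfold smoothstep smoothstepDeriv
    generalize max 0 (min t 1) = c at *
    generalize max 0 (min x 1) = e at *
    rw [show 3 * c ^ 2 - 2 * c ^ 3 - (3 * e ^ 2 - 2 * e ^ 3) - 6 * e * (1 - e) * (c - e) =
      (3 - 4 * e - 2 * c) * (c - e) ^ 2 by ring, abs_mul, abs_of_nonneg (sq_nonneg (c - e))]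
    have h7 : (c - e) ^ 2 ≤ (t - x) ^ 2 := sq_le_sq.mpr h4
    have h8 : |3 - 4 * e - 2 * c| ≤ 3 := abs_le.mpr ⟨by linarith, by linarith⟩
    exact mul_le_mul h8 h7 (sq_nonneg _) (by norm_num)
  calc |smoothstep t - smoothstep x - smoothstepDeriv x * (t - x)|
      = |(smoothstep t - smoothstep x -
          smoothstepDeriv x * (max 0 (min t 1) - max 0 (min x 1))) +
          smoothstepDeriv x * ((max 0 (min t 1) - max 0 (min x 1)) - (t - x))| := by
        congr 1
        ring
    _ ≤ 3 * (t - x) ^ 2 + 6 * (t - x) ^ 2 := (abs_add_le _ _).trans (add_le_add h6 h5)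
    _ = 9 * (t - x) ^ 2 := by ring

theorem smoothstep_nonneg (t : ℝ) : 0 ≤ smoothstep t := by
  have h0 := clamp_nonneg t
  have h1 := clamp_le_one t
  unfold smoothstep
  generalize max 0 (min t 1) = c at *
  nlinarith [mul_nonneg (sq_nonneg c) (sub_nonneg.mpr h1)]

theorem smoothstep_le_one (t : ℝ) : smoothstep t ≤ 1 := by
  have h0 := clamp_nonneg t
  have h1 := clamp_le_one t
  unfold smoothstep
  generalize max 0 (min t 1) = c at *
  nlinarith [mul_nonneg (sq_nonneg (1 - c)) (by linarith : 0 ≤ 1 + 2 * c)]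

theorem smoothstep_of_nonpos {t : ℝ} (ht : t ≤ 0) : smoothstep t = 0 := by
  have : max 0 (min t 1) = 0 := max_eq_left ((min_le_left _ _).trans ht)
  simp [smoothstep, this]

theorem smoothstep_of_one_le {t : ℝ} (ht : 1 ≤ t) : smoothstep t = 1 := by
  norm_num [smoothstep, min_eq_right ht]

theorem smoothstepDeriv_of_nonpos {t : ℝ} (ht : t ≤ 0) : smoothstepDeriv t = 0 := by
  have : max 0 (min t 1) = 0 := max_eq_left ((min_le_left _ _).trans ht)
  simp [smoothstepDeriv, this]

theorem smoothstepDeriv_of_one_le {t : ℝ} (ht : 1 ≤ t) : smoothstepDeriv t = 0 := by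
  norm_num [smoothstepDeriv, min_eq_right ht]

theorem smoothstepDeriv_nonneg (t : ℝ) : 0 ≤ smoothstepDeriv t :=
  mul_nonneg (mul_nonneg (by norm_num) (clamp_nonneg t)) (sub_nonneg.mpr (clamp_le_one t))

theorem smoothstepDeriv_le (t : ℝ) : smoothstepDeriv t ≤ 3 / 2 := by
  unfold smoothstepDeriv
  generalize max 0 (min t 1) = c at *
  nlinarith [sq_nonneg (2 * c - 1)]

theorem le_smoothstepDeriv {t : ℝ} (h1 : 1 / 4 ≤ t) (h2 : t ≤ 3 / 4) :
    1 ≤ smoothstepDeriv t := by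
  have : max 0 (min t 1) = t := by
    rw [min_eq_left (by linarith), max_eq_right (by linarith)]
  rw [smoothstepDeriv, this]
  nlinarith

theorem abs_smoothstep_sub_le (t x : ℝ) : |smoothstep t - smoothstep x| ≤ 3 / 2 * |t - x| := by
  have h := Convex.norm_image_sub_le_of_norm_hasDerivWithin_le (f := smoothstep)
    (f' := smoothstepDeriv) (s := Set.univ) (x := x) (y := t) (C := 3 / 2)
    (fun y _ => (hasDerivAt_smoothstep y).hasDerivWithinAt)
    (fun y _ => by
      rw [Real.norm_of_nonneg (smoothstepDeriv_nonneg y)]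
      exact smoothstepDeriv_le y) convex_univ (Set.mem_univ _) (Set.mem_univ _)
  simpa only [Real.norm_eq_abs] using h

theorem abs_smoothstepDeriv_sub_le (t x : ℝ) :
    |smoothstepDeriv t - smoothstepDeriv x| ≤ 6 * |t - x| := by
  have h0 := clamp_nonneg t
  have h1 := clamp_le_one t
  have h2 := clamp_nonneg x
  have h3 := clamp_le_one x
  have h4 := abs_clamp_sub_le t x
  unfold smoothstepDeriv
  generalize max 0 (min t 1) = c at *
  generalize max 0 (min x 1) = e at *
  rw [show 6 * c * (1 - c) - 6 * e * (1 - e) = 6 * ((1 - c - e) * (c - e)) by ring, abs_mul,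
    abs_mul, abs_of_pos (by norm_num : (0 : ℝ) < 6)]
  have h5 : |1 - c - e| ≤ 1 := abs_le.mpr ⟨by linarith, by linarith⟩
  nlinarith [abs_nonneg (c - e)]

/-- The square root of `mark`. -/
def markRoot (t : ℝ) : ℝ := smoothstep (2 * t - 1)

/-- The profile that measures whether a coordinate has been moved: `0` for `t ≤ 1 / 2` and `1` for
`t ≥ 1`. It is the square of a Lipschitz function. -/
def mark (t : ℝ) : ℝ := markRoot t ^ 2

/-- The derivative of `mark`. -/
def markDeriv (t : ℝ) : ℝ := 4 * markRoot t * smoothstepDeriv (2 * t - 1)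

theorem markRoot_nonneg (t : ℝ) : 0 ≤ markRoot t := smoothstep_nonneg _

theorem markRoot_le_one (t : ℝ) : markRoot t ≤ 1 := smoothstep_le_one _

theorem abs_markRoot_sub_le (t x : ℝ) : |markRoot t - markRoot x| ≤ 3 * |t - x| := by
  have h := abs_smoothstep_sub_le (2 * t - 1) (2 * x - 1)
  rw [show 2 * t - 1 - (2 * x - 1) = 2 * (t - x) by ring, abs_mul, abs_two] at h
  unfold markRoot
  linarith

theorem hasDerivAt_mark (t : ℝ) : HasDerivAt mark (markDeriv t) t := by
  have h1 : HasDerivAt (fun t : ℝ => 2 * t - 1) 2 t := by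
    simpa using ((hasDerivAt_id t).const_mul 2).sub_const 1
  have h2 := ((hasDerivAt_smoothstep (2 * t - 1)).comp t h1).pow 2
  refine h2.congr_deriv ?_
  simp [markDeriv, markRoot]
  ring

theorem mark_nonneg (t : ℝ) : 0 ≤ mark t := sq_nonneg _

theorem mark_le_one (t : ℝ) : mark t ≤ 1 := pow_le_one₀ (markRoot_nonneg t) (markRoot_le_one t)

theorem mark_zero : mark 0 = 0 := by
  simp [mark, markRoot, smoothstep_of_nonpos]

theorem mark_of_one_le {t : ℝ} (ht : 1 ≤ t) : mark t = 1 := by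
  rw [mark, markRoot, smoothstep_of_one_le (by linarith), one_pow]

theorem markDeriv_zero : markDeriv 0 = 0 := by
  simp [markDeriv, markRoot, smoothstep_of_nonpos]

theorem markDeriv_nonneg (t : ℝ) : 0 ≤ markDeriv t :=
  mul_nonneg (mul_nonneg (by norm_num) (markRoot_nonneg t)) (smoothstepDeriv_nonneg _)

theorem markDeriv_le_markRoot (t : ℝ) : markDeriv t ≤ 6 * markRoot t := by
  have h1 := smoothstepDeriv_le (2 * t - 1)
  have h2 := markRoot_nonneg t
  unfold markDeriv
  nlinarith

theorem abs_markDeriv_le (t : ℝ) : |markDeriv t| ≤ 6 := by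
  rw [abs_of_nonneg (markDeriv_nonneg t)]
  linarith [markDeriv_le_markRoot t, markRoot_le_one t]

theorem abs_markDeriv_sub_le (t x : ℝ) : |markDeriv t - markDeriv x| ≤ 66 * |t - x| := by
  have h1 := abs_markRoot_sub_le t x
  have h2 := abs_smoothstepDeriv_sub_le (2 * t - 1) (2 * x - 1)
  rw [show 2 * t - 1 - (2 * x - 1) = 2 * (t - x) by ring, abs_mul, abs_two] at h2
  have h3 := smoothstepDeriv_nonneg (2 * t - 1)
  have h4 := smoothstepDeriv_le (2 * t - 1)
  have h5 := markRoot_nonneg x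
  have h6 := markRoot_le_one x
  unfold markDeriv
  rw [show 4 * markRoot t * smoothstepDeriv (2 * t - 1) -
      4 * markRoot x * smoothstepDeriv (2 * x - 1) =
      4 * ((markRoot t - markRoot x) * smoothstepDeriv (2 * t - 1)) +
      4 * (markRoot x * (smoothstepDeriv (2 * t - 1) - smoothstepDeriv (2 * x - 1))) by ring]
  refine (abs_add_le _ _).trans ?_
  rw [abs_mul, abs_mul, abs_mul, abs_mul, abs_of_nonneg h3, abs_of_nonneg h5,
    abs_of_pos (by norm_num : (0 : ℝ) < 4)]
  have h7 : |markRoot t - markRoot x| * smoothstepDeriv (2 * t - 1) ≤ 3 * |t - x| * (3 / 2) :=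
    mul_le_mul h1 h4 h3 (by positivity)
  have h8 : markRoot x * |smoothstepDeriv (2 * t - 1) - smoothstepDeriv (2 * x - 1)| ≤
      1 * (6 * (2 * |t - x|)) := mul_le_mul h6 h2 (abs_nonneg _) zero_le_one
  linarith

/-- The reward profile, increasing from `0` at `t = -2` to `1` at `t = 2`. -/
def reward (t : ℝ) : ℝ := smoothstep ((t + 2) / 4)

/-- The derivative of `reward`. -/
def rewardDeriv (t : ℝ) : ℝ := smoothstepDeriv ((t + 2) / 4) / 4

theorem hasDerivAt_reward (t : ℝ) : HasDerivAt reward (rewardDeriv t) t := by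
  have h1 : HasDerivAt (fun t : ℝ => (t + 2) / 4) (1 / 4) t :=
    ((hasDerivAt_id t).add_const 2).div_const 4
  have h2 := (hasDerivAt_smoothstep ((t + 2) / 4)).comp t h1
  refine h2.congr_deriv ?_
  simp [rewardDeriv]
  ring

theorem reward_nonneg (t : ℝ) : 0 ≤ reward t := smoothstep_nonneg _

theorem reward_le_one (t : ℝ) : reward t ≤ 1 := smoothstep_le_one _

theorem abs_reward_le (t : ℝ) : |reward t| ≤ 1 := by
  rw [abs_of_nonneg (reward_nonneg t)]
  exact reward_le_one t

theorem rewardDeriv_nonneg (t : ℝ) : 0 ≤ rewardDeriv t :=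
  div_nonneg (smoothstepDeriv_nonneg _) (by norm_num)

theorem abs_rewardDeriv_le (t : ℝ) : |rewardDeriv t| ≤ 1 := by
  rw [abs_of_nonneg (rewardDeriv_nonneg t), rewardDeriv]
  linarith [smoothstepDeriv_le ((t + 2) / 4)]

theorem le_rewardDeriv {t : ℝ} (h1 : -1 ≤ t) (h2 : t ≤ 1) : 1 / 4 ≤ rewardDeriv t := by
  have := le_smoothstepDeriv (t := (t + 2) / 4) (by linarith) (by linarith)
  rw [rewardDeriv]
  linarith

theorem abs_reward_sub_le (t x : ℝ) : |reward t - reward x| ≤ |t - x| := by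
  have h := abs_smoothstep_sub_le ((t + 2) / 4) ((x + 2) / 4)
  rw [show (t + 2) / 4 - (x + 2) / 4 = (t - x) / 4 by ring, abs_div,
    abs_of_pos (by norm_num : (0 : ℝ) < 4)] at h
  unfold reward
  linarith [abs_nonneg (t - x)]

theorem abs_rewardDeriv_sub_le (t x : ℝ) : |rewardDeriv t - rewardDeriv x| ≤ |t - x| := by
  have h := abs_smoothstepDeriv_sub_le ((t + 2) / 4) ((x + 2) / 4)
  rw [show (t + 2) / 4 - (x + 2) / 4 = (t - x) / 4 by ring, abs_div,
    abs_of_pos (by norm_num : (0 : ℝ) < 4)] at h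
  unfold rewardDeriv
  rw [← sub_div, abs_div, abs_of_pos (by norm_num : (0 : ℝ) < 4)]
  linarith [abs_nonneg (t - x)]

/-- The penalty on negative coordinates, which keeps the gradient away from zero where the
derivative of `reward` vanishes on the left. -/
def penalty (t : ℝ) : ℝ := (min t 0) ^ 2 / 2

theorem hasDerivAt_penalty (x : ℝ) : HasDerivAt penalty (min x 0) x := by
  refine hasDerivAt_of_abs_sub_le_sq (C := 1) fun t => ?_
  unfold penalty
  rw [abs_le]
  rcases le_total x 0 with hx | hx <;> rcases le_total t 0 with ht | ht <;>
    simp only [hx, ht, min_eq_left, min_eq_right] <;> constructor <;>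
    nlinarith [sq_nonneg (t - x)]

/-! ### Tame functions -/

/-- `f` is bounded by `C` and has gradient `G`, which is bounded by `C κ` and Lipschitz with
constant `C κ ^ 2`. With `κ = 1 / √m`, these are the bounds satisfied by smooth functions of
averages over a block of `m` coordinates. -/
structure IsTame {E : Type*} [NormedAddCommGroup E] [InnerProductSpace ℝ E] [CompleteSpace E]
    (κ C : ℝ) (f : E → ℝ) (G : E → E) : Prop where
  grad : ∀ y, HasGradientAt f (G y) y
  abs_le : ∀ y, |f y| ≤ C
  norm_le : ∀ y, ‖G y‖ ≤ C * κ
  norm_sub_le : ∀ y z, ‖G y - G z‖ ≤ C * κ ^ 2 * ‖y - z‖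

namespace IsTame

variable {E : Type*} [NormedAddCommGroup E] [InnerProductSpace ℝ E] [CompleteSpace E]
  {κ C C' : ℝ} {f f' : E → ℝ} {G G' : E → E}

theorem const_nonneg (h : IsTame κ C f G) : 0 ≤ C := (abs_nonneg _).trans (h.abs_le 0)

theorem abs_sub_le (h : IsTame κ C f G) (y z : E) : |f y - f z| ≤ C * κ * ‖y - z‖ := by
  have := Convex.norm_image_sub_le_of_norm_hasFDerivWithin_le (f := f) (s := Set.univ)
    (f' := fun x => InnerProductSpace.toDual ℝ E (G x)) (x := z) (y := y) (C := C * κ)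
    (fun x _ => (h.grad x).hasFDerivAt.hasFDerivWithinAt)
    (fun x _ => by
      rw [LinearIsometryEquiv.norm_map]
      exact h.norm_le x) convex_univ (Set.mem_univ _) (Set.mem_univ _)
  simpa only [Real.norm_eq_abs] using this

theorem mul (h : IsTame κ C f G) (h' : IsTame κ C' f' G') (hκ : 0 ≤ κ) :
    IsTame κ (4 * C * C') (fun y => f y * f' y) (fun y => f y • G' y + f' y • G y) where
  grad y := (h.grad y).mul (h'.grad y)
  abs_le y := by
    rw [abs_mul]
    have := mul_le_mul (h.abs_le y) (h'.abs_le y) (abs_nonneg _) h.const_nonneg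
    nlinarith [mul_nonneg h.const_nonneg h'.const_nonneg]
  norm_le y := by
    refine (norm_add_le _ _).trans ?_
    rw [norm_smul, norm_smul, Real.norm_eq_abs, Real.norm_eq_abs]
    have h1 := mul_le_mul (h.abs_le y) (h'.norm_le y) (norm_nonneg _) h.const_nonneg
    have h2 := mul_le_mul (h'.abs_le y) (h.norm_le y) (norm_nonneg _) h'.const_nonneg
    nlinarith [mul_nonneg (mul_nonneg h.const_nonneg h'.const_nonneg) hκ]
  norm_sub_le y z := by
    have e : f y • G' y + f' y • G y - (f z • G' z + f' z • G z) =
        ((f y - f z) • G' y + f z • (G' y - G' z)) +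
        ((f' y - f' z) • G y + f' z • (G y - G z)) := by
      simp only [sub_smul, smul_sub]
      abel
    rw [e]
    refine (norm_add_le _ _).trans ((add_le_add (norm_add_le _ _) (norm_add_le _ _)).trans ?_)
    simp only [norm_smul, Real.norm_eq_abs]
    have h1 := mul_le_mul (h.abs_sub_le y z) (h'.norm_le y) (norm_nonneg _)
      ((abs_nonneg _).trans (h.abs_sub_le y z))
    have h2 := mul_le_mul (h.abs_le z) (h'.norm_sub_le y z) (norm_nonneg _) h.const_nonneg
    have h3 := mul_le_mul (h'.abs_sub_le y z) (h.norm_le y) (norm_nonneg _)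
      ((abs_nonneg _).trans (h'.abs_sub_le y z))
    have h4 := mul_le_mul (h'.abs_le z) (h.norm_sub_le y z) (norm_nonneg _) h'.const_nonneg
    linarith

theorem comp {φ φ' : ℝ → ℝ} {A : ℝ} (h : IsTame κ C f G) (hκ : 0 ≤ κ)
    (hd : ∀ t, HasDerivAt φ (φ' t) t) (h0 : ∀ t, |φ t| ≤ A) (h1 : ∀ t, |φ' t| ≤ A)
    (h2 : ∀ t x, |φ' t - φ' x| ≤ A * |t - x|) :
    IsTame κ (A * (C ^ 2 + C + 1)) (fun y => φ (f y)) (fun y => φ' (f y) • G y) where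
  grad y := (hd (f y)).comp_hasGradientAt (h.grad y)
  abs_le y := by
    have hA := (abs_nonneg _).trans (h0 0)
    have hC := h.const_nonneg
    have := h0 (f y)
    nlinarith [mul_nonneg hA hC, mul_nonneg hA (sq_nonneg C)]
  norm_le y := by
    have hA := (abs_nonneg _).trans (h0 0)
    have hC := h.const_nonneg
    rw [norm_smul, Real.norm_eq_abs]
    have := mul_le_mul (h1 (f y)) (h.norm_le y) (norm_nonneg _) hA
    nlinarith [mul_nonneg (mul_nonneg hA hκ) (sq_nonneg C), mul_nonneg hA hκ]
  norm_sub_le y z := by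
    have hA := (abs_nonneg _).trans (h0 0)
    have hC := h.const_nonneg
    rw [show φ' (f y) • G y - φ' (f z) • G z =
      (φ' (f y) - φ' (f z)) • G y + φ' (f z) • (G y - G z) by
        simp only [sub_smul, smul_sub]
        abel]
    refine (norm_add_le _ _).trans ?_
    rw [norm_smul, norm_smul, Real.norm_eq_abs, Real.norm_eq_abs]
    have e1 : |φ' (f y) - φ' (f z)| ≤ A * (C * κ * ‖y - z‖) :=
      (h2 _ _).trans (mul_le_mul_of_nonneg_left (h.abs_sub_le y z) hA)
    have e2 := mul_le_mul e1 (h.norm_le y) (norm_nonneg _) ((abs_nonneg _).trans e1)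
    have e3 := mul_le_mul (h1 (f z)) (h.norm_sub_le y z) (norm_nonneg _) hA
    have e4 : 0 ≤ A * (κ ^ 2 * ‖y - z‖) := by positivity
    linarith

end IsTame

/-! ### Averages of coordinate profiles -/

section CoordAvg

/-- The sum of `φ (y a)` over the coordinates `a ∈ s`, divided by `m`. -/
def coordAvg {ι : Type*} (m : ℕ) (s : Finset ι) (φ : ℝ → ℝ) (y : EuclideanSpace ℝ ι) : ℝ :=
  (m : ℝ)⁻¹ * ∑ a ∈ s, φ (y a)

theorem abs_coordAvg_le {ι : Type*} {m : ℕ} {s : Finset ι} (hs : s.card ≤ m) {φ : ℝ → ℝ} {B : ℝ}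
    (hB : 0 ≤ B) (h : ∀ t, |φ t| ≤ B) (y : EuclideanSpace ℝ ι) : |coordAvg m s φ y| ≤ B := by
  rw [coordAvg, abs_mul, abs_of_nonneg (by positivity)]
  rcases Nat.eq_zero_or_pos m with rfl | hm
  · simpa using hB
  have hm' : (0 : ℝ) < m := by exact_mod_cast hm
  rw [inv_mul_le_iff₀ hm']
  refine (Finset.abs_sum_le_sum_abs _ _).trans ((Finset.sum_le_card_nsmul _ _ B
    fun a _ => h _).trans ?_)
  rw [nsmul_eq_mul]
  gcongr

/-- The Cauchy-Schwarz bound for differences of averages over at most `m` coordinates. -/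
theorem coordAvg_sub_sq_le {ι : Type*} {m : ℕ} {s : Finset ι} (hs : s.card ≤ m) {φ : ℝ → ℝ} {B : ℝ}
    (h : ∀ t x, |φ t - φ x| ≤ B * |t - x|) (y z : EuclideanSpace ℝ ι) :
    (coordAvg m s φ y - coordAvg m s φ z) ^ 2 ≤
      B ^ 2 * (m : ℝ)⁻¹ * ∑ a ∈ s, (y a - z a) ^ 2 := by
  rcases Nat.eq_zero_or_pos m with rfl | hm
  · simp [coordAvg]
  have hm' : (0 : ℝ) < m := by exact_mod_cast hm
  rw [coordAvg, coordAvg, ← mul_sub, ← Finset.sum_sub_distrib, mul_pow]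
  have h1 : (∑ a ∈ s, (φ (y a) - φ (z a))) ^ 2 ≤ m * ∑ a ∈ s, B ^ 2 * (y a - z a) ^ 2 := by
    refine sq_sum_le_card_mul_sum_sq.trans ?_
    have h2 : ∑ a ∈ s, (φ (y a) - φ (z a)) ^ 2 ≤ ∑ a ∈ s, B ^ 2 * (y a - z a) ^ 2 := by
      refine Finset.sum_le_sum fun a _ => ?_
      have := pow_le_pow_left₀ (abs_nonneg _) (h (y a) (z a)) 2
      rwa [sq_abs, mul_pow, sq_abs] at this
    refine mul_le_mul (by exact_mod_cast hs) h2 (Finset.sum_nonneg fun a _ => sq_nonneg _) hm'.le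
  rw [← Finset.mul_sum] at h1
  calc (m : ℝ)⁻¹ ^ 2 * (∑ a ∈ s, (φ (y a) - φ (z a))) ^ 2
      ≤ (m : ℝ)⁻¹ ^ 2 * (m * (B ^ 2 * ∑ a ∈ s, (y a - z a) ^ 2)) := by gcongr
    _ = _ := by field_simp

variable {ι : Type*} [Fintype ι] [DecidableEq ι]

/-- The gradient of `coordAvg m s φ` when `φ'` is the derivative of `φ`. -/
def coordAvgGrad (m : ℕ) (s : Finset ι) (φ' : ℝ → ℝ) (y : EuclideanSpace ℝ ι) :
    EuclideanSpace ℝ ι :=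
  WithLp.toLp 2 fun a => if a ∈ s then (m : ℝ)⁻¹ * φ' (y a) else 0

theorem hasGradientAt_coord {φ : ℝ → ℝ} {φ' : ℝ} (a : ι) {y : EuclideanSpace ℝ ι}
    (h : HasDerivAt φ φ' (y a)) :
    HasGradientAt (fun y : EuclideanSpace ℝ ι => φ (y a)) (φ' • EuclideanSpace.single a 1) y := by
  have h1 : HasGradientAt (fun y : EuclideanSpace ℝ ι => y a) (EuclideanSpace.single a 1) y := by
    have key : InnerProductSpace.toDual ℝ (EuclideanSpace ℝ ι) (EuclideanSpace.single a 1) =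
        EuclideanSpace.proj a := by
      ext z
      simp [EuclideanSpace.inner_single_left]
    rw [hasGradientAt_iff_hasFDerivAt, key]
    exact (EuclideanSpace.proj (𝕜 := ℝ) a).hasFDerivAt
  exact HasDerivAt.comp_hasGradientAt (f := fun y : EuclideanSpace ℝ ι => y a) h h1

theorem hasGradientAt_coordAvg {m : ℕ} {s : Finset ι} {φ φ' : ℝ → ℝ}
    (h : ∀ t, HasDerivAt φ (φ' t) t) (y : EuclideanSpace ℝ ι) :
    HasGradientAt (coordAvg m s φ) (coordAvgGrad m s φ' y) y := by
  have h1 := (HasGradientAt.sum (s := s) fun a _ => hasGradientAt_coord a (h (y a))).const_mul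
    (m : ℝ)⁻¹
  have e : coordAvgGrad m s φ' y =
      (m : ℝ)⁻¹ • ∑ a ∈ s, φ' (y a) • EuclideanSpace.single a (1 : ℝ) := by
    ext b
    simp [coordAvgGrad, Pi.single_apply]
  rw [e]
  exact h1

theorem norm_coordAvgGrad_sq (m : ℕ) (s : Finset ι) (φ' : ℝ → ℝ) (y : EuclideanSpace ℝ ι) :
    ‖coordAvgGrad m s φ' y‖ ^ 2 = (m : ℝ)⁻¹ ^ 2 * ∑ a ∈ s, φ' (y a) ^ 2 := by
  rw [EuclideanSpace.real_norm_sq_eq, Finset.mul_sum]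
  simp [coordAvgGrad, ite_pow, mul_pow]

theorem norm_coordAvgGrad_sub_le (m : ℕ) (s : Finset ι) {φ' : ℝ → ℝ} {B : ℝ} (hB : 0 ≤ B)
    (h : ∀ t x, |φ' t - φ' x| ≤ B * |t - x|) (y z : EuclideanSpace ℝ ι) :
    ‖coordAvgGrad m s φ' y - coordAvgGrad m s φ' z‖ ≤ B * (m : ℝ)⁻¹ * ‖y - z‖ := by
  refine le_of_sq_le_sq ?_ (by positivity)
  rw [mul_pow, EuclideanSpace.real_norm_sq_eq, EuclideanSpace.real_norm_sq_eq, Finset.mul_sum]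
  refine Finset.sum_le_sum fun a _ => ?_
  simp only [coordAvgGrad, PiLp.sub_apply]
  split_ifs
  · rw [← mul_sub, mul_pow, mul_pow, ← sq_abs (φ' _ - _)]
    have := pow_le_pow_left₀ (abs_nonneg _) (h (y a) (z a)) 2
    rw [mul_pow, sq_abs (y a - z a)] at this
    have h0 : (0 : ℝ) ≤ (m : ℝ)⁻¹ ^ 2 := by positivity
    nlinarith
  · rw [sub_zero, zero_pow two_ne_zero]
    positivity

theorem isTame_coordAvg {m : ℕ} {s : Finset ι} (hs : s.card ≤ m) {φ φ' : ℝ → ℝ} {B κ : ℝ}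
    (hκ : 0 ≤ κ) (hκm : κ ^ 2 = (m : ℝ)⁻¹) (hd : ∀ t, HasDerivAt φ (φ' t) t)
    (h0 : ∀ t, |φ t| ≤ B) (h1 : ∀ t, |φ' t| ≤ B)
    (h2 : ∀ t x, |φ' t - φ' x| ≤ B * |t - x|) :
    IsTame κ B (coordAvg m s φ) (coordAvgGrad m s φ') where
  grad y := hasGradientAt_coordAvg hd y
  abs_le y := abs_coordAvg_le hs ((abs_nonneg _).trans (h0 0)) h0 y
  norm_le y := by
    have hB := (abs_nonneg _).trans (h0 0)
    refine le_of_sq_le_sq ?_ (by positivity)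
    rw [norm_coordAvgGrad_sq, mul_pow, hκm, sq (m : ℝ)⁻¹, mul_assoc, mul_comm (B ^ 2)]
    refine mul_le_mul_of_nonneg_left ?_ (by positivity)
    rcases Nat.eq_zero_or_pos m with rfl | hm
    · simp
      positivity
    have hm' : (0 : ℝ) < m := by exact_mod_cast hm
    rw [inv_mul_le_iff₀ hm']
    refine (Finset.sum_le_card_nsmul _ _ (B ^ 2) fun a _ => ?_).trans ?_
    · rw [← sq_abs]
      exact pow_le_pow_left₀ (abs_nonneg _) (h1 _) 2
    · rw [nsmul_eq_mul]
      gcongr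
  norm_sub_le y z := by
    rw [hκm]
    exact norm_coordAvgGrad_sub_le m s ((abs_nonneg _).trans (h0 0)) h2 y z

end CoordAvg

/-! ### The noise cut-off -/

section Quiet

variable {ι : Type*} [Fintype ι] [DecidableEq ι]

/-- `1` as long as the average of the marks over `s` is at most `1 / 2`, and `0` once it is at
least `3 / 4`. -/
def quiet (m : ℕ) (s : Finset ι) (y : EuclideanSpace ℝ ι) : ℝ :=
  1 - smoothstep (4 * coordAvg m s mark y - 2)

/-- The gradient of `quiet`. -/
def quietGrad (m : ℕ) (s : Finset ι) (y : EuclideanSpace ℝ ι) : EuclideanSpace ℝ ι :=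
  (-(4 * smoothstepDeriv (4 * coordAvg m s mark y - 2))) • coordAvgGrad m s markDeriv y

theorem coordAvg_mark_nonneg {ι : Type*} (m : ℕ) (s : Finset ι) (y : EuclideanSpace ℝ ι) :
    0 ≤ coordAvg m s mark y :=
  mul_nonneg (by positivity) (Finset.sum_nonneg fun _ _ => mark_nonneg _)

/-- The square root of an average of marks is Lipschitz with a constant that does not depend on the
number of coordinates, because `mark` is the square of a Lipschitz function. -/
theorem abs_sqrt_coordAvg_mark_sub_le {m : ℕ} (s : Finset ι) {κ : ℝ} (hκ : 0 ≤ κ)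
    (hκm : κ ^ 2 = (m : ℝ)⁻¹) (y z : EuclideanSpace ℝ ι) :
    |√(coordAvg m s mark y) - √(coordAvg m s mark z)| ≤ 3 * κ * ‖y - z‖ := by
  set w : EuclideanSpace ℝ ι → EuclideanSpace ℝ ι := fun y =>
    WithLp.toLp 2 fun a => if a ∈ s then κ * markRoot (y a) else 0 with hw
  have h1 : ∀ y, √(coordAvg m s mark y) = ‖w y‖ := fun y => by
    rw [← Real.sqrt_sq (norm_nonneg (w y)), EuclideanSpace.real_norm_sq_eq]
    congr 1
    simp [hw, coordAvg, mark, ite_pow, mul_pow, hκm, Finset.mul_sum]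
  rw [h1, h1]
  refine (abs_norm_sub_norm_le _ _).trans (le_of_sq_le_sq ?_ (by positivity))
  rw [mul_pow, EuclideanSpace.real_norm_sq_eq, EuclideanSpace.real_norm_sq_eq, Finset.mul_sum]
  refine Finset.sum_le_sum fun a _ => ?_
  simp only [hw, PiLp.sub_apply]
  split_ifs
  · rw [← mul_sub, mul_pow, mul_pow, ← sq_abs (markRoot _ - _)]
    have := pow_le_pow_left₀ (abs_nonneg _) (abs_markRoot_sub_le (y a) (z a)) 2
    rw [mul_pow, sq_abs (y a - z a)] at this
    nlinarith [sq_nonneg κ]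
  · rw [sub_zero, zero_pow two_ne_zero]
    positivity

theorem norm_coordAvgGrad_mark_le {m : ℕ} (s : Finset ι) {κ : ℝ} (hκ : 0 ≤ κ)
    (hκm : κ ^ 2 = (m : ℝ)⁻¹) (y : EuclideanSpace ℝ ι) :
    ‖coordAvgGrad m s markDeriv y‖ ≤ 6 * κ * √(coordAvg m s mark y) := by
  refine le_of_sq_le_sq ?_ (by positivity)
  rw [norm_coordAvgGrad_sq, mul_pow, Real.sq_sqrt (coordAvg_mark_nonneg m s y), mul_pow, hκm,
    coordAvg, Finset.mul_sum, Finset.mul_sum, Finset.mul_sum]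
  refine Finset.sum_le_sum fun a _ => ?_
  have h1 : markDeriv (y a) ^ 2 ≤ 36 * mark (y a) := by
    have := pow_le_pow_left₀ (markDeriv_nonneg _) (markDeriv_le_markRoot (y a)) 2
    rw [mul_pow] at this
    unfold mark
    linarith
  have h2 : (0 : ℝ) ≤ (m : ℝ)⁻¹ ^ 2 := by positivity
  nlinarith

/-- Both bounds are uniform in the size of `s`: where `quiet` varies, the average of the marks is
less than `3 / 4`, and the gradient of that average is controlled by its square root. -/
theorem isTame_quiet {m : ℕ} (s : Finset ι) {κ : ℝ} (hκ : 0 ≤ κ) (hκm : κ ^ 2 = (m : ℝ)⁻¹) :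
    IsTame κ 4000 (quiet m s) (quietGrad m s) where
  grad y := by
    have h1 := ((hasGradientAt_coordAvg (m := m) (s := s) hasDerivAt_mark y).const_mul 4).sub
      (hasGradientAt_const y 2)
    have h2 := (hasDerivAt_smoothstep (4 * coordAvg m s mark y - 2)).comp_hasGradientAt
      (f := fun y => 4 * coordAvg m s mark y - 2) h1
    have h3 := (hasGradientAt_const y (1 : ℝ)).sub h2
    have e : quietGrad m s y = 0 - smoothstepDeriv (4 * coordAvg m s mark y - 2) •
        ((4 : ℝ) • coordAvgGrad m s markDeriv y - 0) := by
      rw [quietGrad, sub_zero, zero_sub, smul_smul, neg_smul, mul_comm]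
    rw [e]
    exact h3
  abs_le y := by
    have h1 := smoothstep_nonneg (4 * coordAvg m s mark y - 2)
    have h2 := smoothstep_le_one (4 * coordAvg m s mark y - 2)
    rw [quiet, abs_of_nonneg (by linarith)]
    linarith
  norm_le y := by
    rw [quietGrad, norm_smul, norm_neg, Real.norm_of_nonneg
      (mul_nonneg (by norm_num) (smoothstepDeriv_nonneg _))]
    rcases le_total (3 / 4) (coordAvg m s mark y) with h | h
    · rw [smoothstepDeriv_of_one_le (by linarith)]
      simpa using by positivity
    · have h1 := norm_coordAvgGrad_mark_le s hκ hκm y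
      have h2 := smoothstepDeriv_le (4 * coordAvg m s mark y - 2)
      have h3 : √(coordAvg m s mark y) ≤ 1 := Real.sqrt_le_one.mpr (by linarith)
      have h4 : ‖coordAvgGrad m s markDeriv y‖ ≤ 6 * κ := h1.trans (by nlinarith)
      have h5 := mul_le_mul h2 h4 (norm_nonneg _) (by norm_num)
      linarith
  norm_sub_le y z := by
    set ρ : EuclideanSpace ℝ ι → ℝ := fun y => √(coordAvg m s mark y) with hρ
    set c : EuclideanSpace ℝ ι → ℝ :=
      fun y => 4 * smoothstepDeriv (4 * coordAvg m s mark y - 2) with hc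
    have hρ0 : ∀ y, 0 ≤ ρ y := fun y => Real.sqrt_nonneg _
    have hρsq : ∀ y, ρ y ^ 2 = coordAvg m s mark y := fun y =>
      Real.sq_sqrt (coordAvg_mark_nonneg m s y)
    have hc6 : ∀ y, |c y| ≤ 6 := fun y => by
      rw [hc, abs_of_nonneg (mul_nonneg (by norm_num) (smoothstepDeriv_nonneg _))]
      linarith [smoothstepDeriv_le (4 * coordAvg m s mark y - 2)]
    have hc1 : ∀ y, c y = 4 * smoothstepDeriv (4 * min (ρ y) 1 ^ 2 - 2) := fun y => by
      rcases le_total (ρ y) 1 with h | h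
      · rw [min_eq_left h, hρsq]
      · rw [min_eq_right h, smoothstepDeriv_of_one_le (by norm_num), hc]
        simp only
        rw [← hρsq, smoothstepDeriv_of_one_le (by nlinarith)]
    have hcL : ∀ y z, |c y - c z| ≤ 576 * κ * ‖y - z‖ := fun y z => by
      rw [hc1, hc1, ← mul_sub, abs_mul, abs_of_pos (by norm_num : (0 : ℝ) < 4)]
      have h1 := abs_smoothstepDeriv_sub_le (4 * min (ρ y) 1 ^ 2 - 2) (4 * min (ρ z) 1 ^ 2 - 2)
      have h2 : |min (ρ y) 1 - min (ρ z) 1| ≤ |ρ y - ρ z| := by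
        simpa using abs_min_sub_min_le_max (ρ y) 1 (ρ z) 1
      have h3 := abs_sqrt_coordAvg_mark_sub_le s hκ hκm y z
      change |ρ y - ρ z| ≤ _ at h3
      have h4 : |min (ρ y) 1 + min (ρ z) 1| ≤ 2 := by
        rw [abs_of_nonneg (add_nonneg (le_min (hρ0 y) zero_le_one) (le_min (hρ0 z) zero_le_one))]
        linarith [min_le_right (ρ y) 1, min_le_right (ρ z) 1]
      rw [show 4 * min (ρ y) 1 ^ 2 - 2 - (4 * min (ρ z) 1 ^ 2 - 2) =
        4 * ((min (ρ y) 1 + min (ρ z) 1) * (min (ρ y) 1 - min (ρ z) 1)) by ring, abs_mul, abs_mul,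
        abs_of_pos (by norm_num : (0 : ℝ) < 4)] at h1
      have h5 := mul_le_mul h4 (h2.trans h3) (abs_nonneg _) zero_le_two
      linarith
    have hG : ∀ y, coordAvg m s mark y ≤ 3 / 4 → ‖coordAvgGrad m s markDeriv y‖ ≤ 6 * κ :=
      fun y h => by
        have h1 := norm_coordAvgGrad_mark_le s hκ hκm y
        have h3 : √(coordAvg m s mark y) ≤ 1 := Real.sqrt_le_one.mpr (by linarith)
        exact h1.trans (by nlinarith)
    have hGL := norm_coordAvgGrad_sub_le m s (by norm_num) abs_markDeriv_sub_le y z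
    rw [← hκm] at hGL
    -- The two vectors enter asymmetrically, so the bound is needed for both orders.
    have key : ∀ u v : EuclideanSpace ℝ ι, coordAvg m s mark u ≤ 3 / 4 →
        ‖coordAvgGrad m s markDeriv u - coordAvgGrad m s markDeriv v‖ ≤ 66 * κ ^ 2 * ‖u - v‖ →
        ‖quietGrad m s u - quietGrad m s v‖ ≤ 4000 * κ ^ 2 * ‖u - v‖ := fun u v hu huv => by
      have e : quietGrad m s u - quietGrad m s v = -((c u - c v) • coordAvgGrad m s markDeriv u +
          c v • (coordAvgGrad m s markDeriv u - coordAvgGrad m s markDeriv v)) := by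
        simp only [quietGrad, hc, sub_smul, smul_sub, neg_smul]
        abel
      rw [e, norm_neg]
      refine (norm_add_le _ _).trans ?_
      rw [norm_smul, norm_smul, Real.norm_eq_abs, Real.norm_eq_abs]
      have h1 := mul_le_mul (hcL u v) (hG u hu) (norm_nonneg _) (by positivity)
      have h2 := mul_le_mul (hc6 v) huv (norm_nonneg _) (by norm_num)
      have h3 : 0 ≤ κ ^ 2 * ‖u - v‖ := by positivity
      linarith
    rcases le_total (coordAvg m s mark y) (3 / 4) with hy | hy
    · exact key y z hy hGL
    rcases le_total (coordAvg m s mark z) (3 / 4) with hz | hz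
    · rw [norm_sub_rev (quietGrad m s y), norm_sub_rev y]
      refine key z y hz ?_
      rw [norm_sub_rev, norm_sub_rev z]
      exact hGL
    · rw [quietGrad, quietGrad, smoothstepDeriv_of_one_le (by linarith),
        smoothstepDeriv_of_one_le (by linarith)]
      simp
      positivity

end Quiet

/-! ### The chain of blocks -/

section Chain

variable (T m : ℕ)

/-- The coordinates of block `k`. -/
def block (k : ℕ) : Finset (Fin T × Fin m) := Finset.univ.filter fun a => a.1.val = k

/-- The coordinates of the block before block `k`. -/
def prevBlock (k : ℕ) : Finset (Fin T × Fin m) := Finset.univ.filter fun a => a.1.val + 1 = k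

/-- The coordinates of block `k` and of all later blocks. -/
def laterBlocks (k : ℕ) : Finset (Fin T × Fin m) := Finset.univ.filter fun a => k ≤ a.1.val

variable {T m}

theorem card_le_of_fst_eq {s : Finset (Fin T × Fin m)}
    (h : ∀ a ∈ s, ∀ b ∈ s, a.1 = b.1) : s.card ≤ m := by
  have := Finset.card_le_card_of_injOn (s := s) (t := (Finset.univ : Finset (Fin m))) Prod.snd
    (fun _ _ => Finset.mem_coe.mpr (Finset.mem_univ _))
    (fun a ha b hb hab => Prod.ext (h a ha b hb) hab)
  simpa using this

theorem card_block_le (k : ℕ) : (block T m k).card ≤ m :=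
  card_le_of_fst_eq fun a ha b hb => by
    simp only [block, Finset.mem_filter, Finset.mem_univ, true_and] at ha hb
    exact Fin.ext (ha.trans hb.symm)

theorem card_prevBlock_le (k : ℕ) : (prevBlock T m k).card ≤ m :=
  card_le_of_fst_eq fun a ha b hb => by
    simp only [prevBlock, Finset.mem_filter, Finset.mem_univ, true_and] at ha hb
    exact Fin.ext (by omega)

theorem prevBlock_succ (k : ℕ) : prevBlock T m (k + 1) = block T m k := by
  simp [prevBlock, block]

theorem prevBlock_zero : prevBlock T m 0 = ∅ := by
  simp [prevBlock]

theorem block_eq_image (k : Fin T) :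
    block T m k = Finset.univ.map ⟨fun j => (k, j), fun _ _ h => (Prod.mk.inj h).2⟩ := by
  ext ⟨i, j⟩
  rw [block, Finset.mem_filter, Finset.mem_map]
  constructor
  · rintro ⟨-, h⟩
    exact ⟨j, Finset.mem_univ _, Prod.ext (Fin.ext h.symm) rfl⟩
  · rintro ⟨j', -, h⟩
    exact ⟨Finset.mem_univ _, congrArg (fun a => a.1.val) h.symm⟩

theorem card_block (k : Fin T) : (block T m k).card = m := by
  simp [block_eq_image]

/-- The degree to which block `k` is unlocked: the average mark over the preceding block, and `1`
for the first block. -/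
def unlock (k : ℕ) (y : EuclideanSpace ℝ (Fin T × Fin m)) : ℝ :=
  (if k = 0 then 1 else 0) + coordAvg m (prevBlock T m k) mark y

/-- The gate of block `k`: closed (`0`) if `unlock ≤ 3 / 4`, open (`1`) if `unlock ≥ 7 / 8`. -/
def gate (k : ℕ) (y : EuclideanSpace ℝ (Fin T × Fin m)) : ℝ := smoothstep (8 * unlock k y - 6)

/-- The derivative of the gate as a function of `unlock`. -/
def gateSlope (k : ℕ) (y : EuclideanSpace ℝ (Fin T × Fin m)) : ℝ :=
  8 * smoothstepDeriv (8 * unlock k y - 6)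

/-- The gradient of `gate`. -/
def gateGrad (k : ℕ) (y : EuclideanSpace ℝ (Fin T × Fin m)) : EuclideanSpace ℝ (Fin T × Fin m) :=
  gateSlope k y • coordAvgGrad m (prevBlock T m k) markDeriv y

/-- The weight of the noise in block `k`: it is positive only if the gate of the block is not closed
and the average mark over block `k` and all later blocks is less than `3 / 4`. -/
def weight (k : ℕ) (y : EuclideanSpace ℝ (Fin T × Fin m)) : ℝ :=
  gate k y * quiet m (laterBlocks T m k) y

/-- The gradient of `weight`. -/
def weightGrad (k : ℕ) (y : EuclideanSpace ℝ (Fin T × Fin m)) :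
    EuclideanSpace ℝ (Fin T × Fin m) :=
  gate k y • quietGrad m (laterBlocks T m k) y + quiet m (laterBlocks T m k) y • gateGrad k y

/-- A bound for the weights and for their derivatives on the scale of a block. -/
def weightBound : ℝ := 4 * (384 * (66 ^ 2 + 66 + 1)) * 4000

theorem abs_mark_le (t : ℝ) : |mark t| ≤ 6 := by
  rw [abs_of_nonneg (mark_nonneg t)]
  linarith [mark_le_one t]

theorem isTame_unlock {κ : ℝ} (hκ : 0 ≤ κ) (hκm : κ ^ 2 = (m : ℝ)⁻¹) (k : ℕ) :
    IsTame κ 66 (unlock (T := T) (m := m) k) (coordAvgGrad m (prevBlock T m k) markDeriv) where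
  grad y := by
    have := (hasGradientAt_const y (if k = 0 then (1 : ℝ) else 0)).add
      (hasGradientAt_coordAvg (m := m) (s := prevBlock T m k) hasDerivAt_mark y)
    rwa [zero_add] at this
  abs_le y := by
    have h1 := abs_coordAvg_le (card_prevBlock_le k) (by norm_num) abs_mark_le y
    refine (abs_add_le _ _).trans ?_
    have h2 : |(if k = 0 then (1 : ℝ) else 0)| ≤ 1 := by split_ifs <;> simp
    linarith
  norm_le y := (isTame_coordAvg (card_prevBlock_le k) hκ hκm hasDerivAt_mark
    (fun t => (abs_mark_le t).trans (by norm_num)) (fun t => (abs_markDeriv_le t).trans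
      (by norm_num)) abs_markDeriv_sub_le).norm_le y
  norm_sub_le y z := (isTame_coordAvg (card_prevBlock_le k) hκ hκm hasDerivAt_mark
    (fun t => (abs_mark_le t).trans (by norm_num)) (fun t => (abs_markDeriv_le t).trans
      (by norm_num)) abs_markDeriv_sub_le).norm_sub_le y z

theorem hasDerivAt_smoothstep_gate (u : ℝ) :
    HasDerivAt (fun u => smoothstep (8 * u - 6)) (8 * smoothstepDeriv (8 * u - 6)) u := by
  have h1 : HasDerivAt (fun u : ℝ => 8 * u - 6) 8 u := by
    simpa using ((hasDerivAt_id u).const_mul 8).sub_const 6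
  refine ((hasDerivAt_smoothstep (8 * u - 6)).comp u h1).congr_deriv ?_
  ring

theorem abs_gateProfileDeriv_le (u : ℝ) : |8 * smoothstepDeriv (8 * u - 6)| ≤ 12 := by
  rw [abs_of_nonneg (mul_nonneg (by norm_num) (smoothstepDeriv_nonneg _))]
  linarith [smoothstepDeriv_le (8 * u - 6)]

theorem abs_gateProfileDeriv_sub_le (u w : ℝ) :
    |8 * smoothstepDeriv (8 * u - 6) - 8 * smoothstepDeriv (8 * w - 6)| ≤ 384 * |u - w| := by
  have := abs_smoothstepDeriv_sub_le (8 * u - 6) (8 * w - 6)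
  rw [show 8 * u - 6 - (8 * w - 6) = 8 * (u - w) by ring, abs_mul,
    abs_of_pos (by norm_num : (0 : ℝ) < 8)] at this
  rw [← mul_sub, abs_mul, abs_of_pos (by norm_num : (0 : ℝ) < 8)]
  linarith

theorem isTame_gate {κ : ℝ} (hκ : 0 ≤ κ) (hκm : κ ^ 2 = (m : ℝ)⁻¹) (k : ℕ) :
    IsTame κ (384 * (66 ^ 2 + 66 + 1)) (gate (T := T) (m := m) k) (gateGrad k) :=
  (isTame_unlock hκ hκm k).comp (φ := fun u => smoothstep (8 * u - 6))
    (φ' := fun u => 8 * smoothstepDeriv (8 * u - 6)) hκ hasDerivAt_smoothstep_gate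
    (fun t => by
      rw [abs_of_nonneg (smoothstep_nonneg _)]
      linarith [smoothstep_le_one (8 * t - 6)])
    (fun t => (abs_gateProfileDeriv_le t).trans (by norm_num))
    abs_gateProfileDeriv_sub_le

theorem isTame_weight {κ : ℝ} (hκ : 0 ≤ κ) (hκm : κ ^ 2 = (m : ℝ)⁻¹) (k : ℕ) :
    IsTame κ weightBound (weight (T := T) (m := m) k) (weightGrad k) :=
  (isTame_gate hκ hκm k).mul (isTame_quiet (laterBlocks T m k) hκ hκm) hκ

theorem gate_nonneg (k : ℕ) (y : EuclideanSpace ℝ (Fin T × Fin m)) : 0 ≤ gate k y :=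
  smoothstep_nonneg _

theorem gate_le_one (k : ℕ) (y : EuclideanSpace ℝ (Fin T × Fin m)) : gate k y ≤ 1 :=
  smoothstep_le_one _

theorem gateSlope_nonneg (k : ℕ) (y : EuclideanSpace ℝ (Fin T × Fin m)) : 0 ≤ gateSlope k y :=
  mul_nonneg (by norm_num) (smoothstepDeriv_nonneg _)

theorem gate_eq_zero {k : ℕ} {y : EuclideanSpace ℝ (Fin T × Fin m)} (h : unlock k y ≤ 3 / 4) :
    gate k y = 0 := smoothstep_of_nonpos (by linarith)

theorem gate_eq_one {k : ℕ} {y : EuclideanSpace ℝ (Fin T × Fin m)} (h : 7 / 8 ≤ unlock k y) :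
    gate k y = 1 := smoothstep_of_one_le (by linarith)

/-- Block `k` is active at `y`: unlocked, with little marked in it and in later blocks. Only active
blocks carry noise. -/
def Active (k : ℕ) (y : EuclideanSpace ℝ (Fin T × Fin m)) : Prop :=
  3 / 4 < unlock k y ∧ coordAvg m (laterBlocks T m k) mark y < 3 / 4

theorem weight_eq_zero_of_not_active {k : ℕ} {y : EuclideanSpace ℝ (Fin T × Fin m)}
    (h : ¬ Active k y) : weight k y = 0 ∧ weightGrad k y = 0 := by
  rw [Active, not_and_or, not_lt, not_lt] at h
  rcases h with h | h
  · have h1 := gate_eq_zero h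
    have h2 : gateSlope k y = 0 := by
      rw [gateSlope, smoothstepDeriv_of_nonpos (by linarith), mul_zero]
    simp [weight, weightGrad, gateGrad, h1, h2]
  · have h1 : quiet m (laterBlocks T m k) y = 0 := by
      rw [quiet, smoothstep_of_one_le (by linarith), sub_self]
    have h2 : quietGrad m (laterBlocks T m k) y = 0 := by
      rw [quietGrad, smoothstepDeriv_of_one_le (by linarith)]
      simp
    simp [weight, weightGrad, h1, h2]

theorem coordAvg_mark_mono {s s' : Finset (Fin T × Fin m)} (h : s ⊆ s')
    (y : EuclideanSpace ℝ (Fin T × Fin m)) : coordAvg m s mark y ≤ coordAvg m s' mark y :=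
  mul_le_mul_of_nonneg_left
    (Finset.sum_le_sum_of_subset_of_nonneg h fun _ _ _ => mark_nonneg _) (by positivity)

/-- The marks that unlock a block after `k` lie in block `k` or later. -/
theorem unlock_le_of_lt {k l : ℕ} (h : k < l) (y : EuclideanSpace ℝ (Fin T × Fin m)) :
    unlock l y ≤ coordAvg m (laterBlocks T m k) mark y := by
  rw [unlock, if_neg (by omega), zero_add]
  refine coordAvg_mark_mono (fun a ha => ?_) y
  simp only [prevBlock, laterBlocks, Finset.mem_filter, Finset.mem_univ, true_and] at ha ⊢
  omega

theorem Active.eq {k l : ℕ} {y : EuclideanSpace ℝ (Fin T × Fin m)} (hk : Active k y)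
    (hl : Active l y) : k = l := by
  rcases lt_trichotomy k l with h | h | h
  · linarith [unlock_le_of_lt h y, hk.2, hl.1]
  · exact h
  · linarith [unlock_le_of_lt h y, hl.2, hk.1]

/-! ### The noise -/

/-- The reward of the coordinate `(k, j)`, weighted by the noise weight of block `k`. -/
def noiseTerm (k : Fin T) (j : Fin m) (y : EuclideanSpace ℝ (Fin T × Fin m)) : ℝ :=
  weight k y * reward (y (k, j))

/-- The gradient of `noiseTerm`. -/
def noiseTermGrad (k : Fin T) (j : Fin m) (y : EuclideanSpace ℝ (Fin T × Fin m)) :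
    EuclideanSpace ℝ (Fin T × Fin m) :=
  weight k y • rewardDeriv (y (k, j)) • EuclideanSpace.single (k, j) (1 : ℝ) +
    reward (y (k, j)) • weightGrad k y

/-- The noise function of component `j`. -/
def noise (j : Fin m) (y : EuclideanSpace ℝ (Fin T × Fin m)) : ℝ := ∑ k : Fin T, noiseTerm k j y

/-- The gradient of `noise`. -/
def noiseGrad (j : Fin m) (y : EuclideanSpace ℝ (Fin T × Fin m)) :
    EuclideanSpace ℝ (Fin T × Fin m) := ∑ k : Fin T, noiseTermGrad k j y

theorem one_le_weightBound : 1 ≤ weightBound := by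
  unfold weightBound
  norm_num

theorem hasGradientAt_noise {κ : ℝ} (hκ : 0 ≤ κ) (hκm : κ ^ 2 = (m : ℝ)⁻¹) (j : Fin m)
    (y : EuclideanSpace ℝ (Fin T × Fin m)) : HasGradientAt (noise j) (noiseGrad j y) y :=
  HasGradientAt.sum fun k _ => ((isTame_weight hκ hκm k).grad y).mul
    (hasGradientAt_coord (k, j) (hasDerivAt_reward _))

theorem noiseTermGrad_eq_zero {k : Fin T} {y : EuclideanSpace ℝ (Fin T × Fin m)}
    (h : ¬ Active (k : ℕ) y) (j : Fin m) : noiseTermGrad k j y = 0 := by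
  obtain ⟨h1, h2⟩ := weight_eq_zero_of_not_active h
  simp [noiseTermGrad, h1, h2]

theorem norm_noiseTermGrad_le {κ : ℝ} (hκ : 0 ≤ κ) (hκ1 : κ ≤ 1) (hκm : κ ^ 2 = (m : ℝ)⁻¹)
    (k : Fin T) (j : Fin m) (y : EuclideanSpace ℝ (Fin T × Fin m)) :
    ‖noiseTermGrad k j y‖ ≤ 2 * weightBound := by
  have hw := isTame_weight (T := T) hκ hκm k
  have hC := one_le_weightBound
  refine (norm_add_le _ _).trans ?_
  rw [norm_smul, norm_smul, norm_smul, PiLp.norm_single, norm_one, mul_one,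
    Real.norm_eq_abs, Real.norm_eq_abs, Real.norm_eq_abs]
  have h1 := mul_le_mul (hw.abs_le y) (abs_rewardDeriv_le (y (k, j))) (abs_nonneg _)
    hw.const_nonneg
  have h2 := mul_le_mul (abs_reward_le (y (k, j))) (hw.norm_le y) (norm_nonneg _) zero_le_one
  nlinarith

theorem norm_noiseTermGrad_sub_le {κ : ℝ} (hκ : 0 ≤ κ) (hκ1 : κ ≤ 1) (hκm : κ ^ 2 = (m : ℝ)⁻¹)
    (k : Fin T) (j : Fin m) (y z : EuclideanSpace ℝ (Fin T × Fin m)) :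
    ‖noiseTermGrad k j y - noiseTermGrad k j z‖ ≤
      2 * weightBound * (κ * ‖y - z‖ + |y (k, j) - z (k, j)|) := by
  have hw := isTame_weight (T := T) hκ hκm k
  have hC := one_le_weightBound
  set e : EuclideanSpace ℝ (Fin T × Fin m) := EuclideanSpace.single (k, j) (1 : ℝ) with he
  have he1 : ‖e‖ = 1 := by
    rw [he, PiLp.norm_single, norm_one]
  have hsplit : noiseTermGrad k j y - noiseTermGrad k j z =
      (((weight k y - weight k z) * rewardDeriv (y (k, j))) • e +
        (weight k z * (rewardDeriv (y (k, j)) - rewardDeriv (z (k, j)))) • e) +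
      ((reward (y (k, j)) - reward (z (k, j))) • weightGrad k y +
        reward (z (k, j)) • (weightGrad k y - weightGrad k z)) := by
    simp only [noiseTermGrad, ← he, sub_smul, smul_sub, smul_smul, sub_mul, mul_sub]
    abel
  rw [hsplit]
  refine (norm_add_le _ _).trans ((add_le_add (norm_add_le _ _) (norm_add_le _ _)).trans ?_)
  simp only [norm_smul, he1, mul_one, Real.norm_eq_abs, abs_mul]
  set δ := |y (k, j) - z (k, j)|
  have hδ : 0 ≤ δ := abs_nonneg _
  have hn : 0 ≤ ‖y - z‖ := norm_nonneg _
  have h1 := mul_le_mul (hw.abs_sub_le y z) (abs_rewardDeriv_le (y (k, j))) (abs_nonneg _)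
    ((abs_nonneg _).trans (hw.abs_sub_le y z))
  have h2 := mul_le_mul (hw.abs_le z) (abs_rewardDeriv_sub_le (y (k, j)) (z (k, j)))
    (abs_nonneg _) hw.const_nonneg
  have h3 := mul_le_mul (abs_reward_sub_le (y (k, j)) (z (k, j))) (hw.norm_le y) (norm_nonneg _) hδ
  have h4 := mul_le_mul (abs_reward_le (z (k, j))) (hw.norm_sub_le y z) (norm_nonneg _) zero_le_one
  have h5 : weightBound * κ ^ 2 * ‖y - z‖ ≤ weightBound * κ * ‖y - z‖ := by
    have : κ ^ 2 ≤ κ := by nlinarith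
    gcongr
  have h6 : δ * (weightBound * κ) ≤ weightBound * δ := by
    have : weightBound * δ * κ ≤ weightBound * δ * 1 := by gcongr
    linarith
  linarith

/-- Only one block is active at a time, so the second moment of the noise gradients does not grow
with the number of blocks. -/
theorem sum_norm_noiseGrad_sq_le {κ : ℝ} (hκ : 0 ≤ κ) (hκ1 : κ ≤ 1) (hκm : κ ^ 2 = (m : ℝ)⁻¹)
    (hm : 1 ≤ m) (y : EuclideanSpace ℝ (Fin T × Fin m)) :
    (∑ j, ‖noiseGrad j y‖ ^ 2) / m ≤ 4 * weightBound ^ 2 := by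
  classical
  have hm0 : (0 : ℝ) < m := by exact_mod_cast hm
  have hC := one_le_weightBound
  have h1 : ∀ j, ‖noiseGrad j y‖ ^ 2 ≤ 4 * weightBound ^ 2 := fun j => by
    have h2 : ‖noiseGrad j y‖ ≤ 2 * weightBound := by
      by_cases h : ∃ k : Fin T, Active (k : ℕ) y
      · obtain ⟨k, hk⟩ := h
        rw [noiseGrad, Finset.sum_eq_single k (fun l _ hl => noiseTermGrad_eq_zero
          (fun hl' => hl (Fin.ext (hl'.eq hk))) j) (fun h => absurd (Finset.mem_univ _) h)]
        exact norm_noiseTermGrad_le hκ hκ1 hκm k j y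
      · push Not at h
        rw [noiseGrad, Finset.sum_eq_zero fun l _ => noiseTermGrad_eq_zero (h l) j, norm_zero]
        positivity
    have := pow_le_pow_left₀ (norm_nonneg _) h2 2
    linarith
  rw [div_le_iff₀ hm0]
  refine (Finset.sum_le_card_nsmul _ _ _ fun j _ => h1 j).trans ?_
  simp [mul_comm]

/-- At most two blocks are active at one of two given points, so the mean squared Lipschitz constant
of the noise gradients does not grow with the number of blocks. -/
theorem sum_norm_noiseGrad_sub_sq_le {κ : ℝ} (hκ : 0 ≤ κ) (hκ1 : κ ≤ 1)
    (hκm : κ ^ 2 = (m : ℝ)⁻¹) (hm : 1 ≤ m) (y z : EuclideanSpace ℝ (Fin T × Fin m)) :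
    (∑ j, ‖noiseGrad j y - noiseGrad j z‖ ^ 2) / m ≤
      64 * weightBound ^ 2 / m * ‖y - z‖ ^ 2 := by
  classical
  have hm0 : (0 : ℝ) < m := by exact_mod_cast hm
  set A : Finset (Fin T) := Finset.univ.filter fun k => Active (k : ℕ) y ∨ Active (k : ℕ) z with hA
  have hcard : A.card ≤ 2 := by
    have h1 : ∀ x : EuclideanSpace ℝ (Fin T × Fin m),
        (Finset.univ.filter fun k : Fin T => Active (k : ℕ) x).card ≤ 1 := fun x => by
      refine Finset.card_le_one.mpr fun k hk l hl => ?_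
      simp only [Finset.mem_filter, Finset.mem_univ, true_and] at hk hl
      exact Fin.ext (hk.eq hl)
    rw [hA, Finset.filter_or]
    exact (Finset.card_union_le _ _).trans (add_le_add (h1 y) (h1 z))
  have hterm : ∀ j, ‖noiseGrad j y - noiseGrad j z‖ ^ 2 ≤ 2 * ∑ k ∈ A, (2 * weightBound *
      (κ * ‖y - z‖ + |y (k, j) - z (k, j)|)) ^ 2 := fun j => by
    have h1 : noiseGrad j y - noiseGrad j z =
        ∑ k ∈ A, (noiseTermGrad k j y - noiseTermGrad k j z) := by
      rw [noiseGrad, noiseGrad, ← Finset.sum_sub_distrib]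
      refine (Finset.sum_subset (Finset.subset_univ A) fun k _ hk => ?_).symm
      simp only [hA, Finset.mem_filter, Finset.mem_univ, true_and, not_or] at hk
      rw [noiseTermGrad_eq_zero hk.1, noiseTermGrad_eq_zero hk.2, sub_zero]
    have h2 : ‖noiseGrad j y - noiseGrad j z‖ ≤
        ∑ k ∈ A, 2 * weightBound * (κ * ‖y - z‖ + |y (k, j) - z (k, j)|) := by
      rw [h1]
      exact (norm_sum_le _ _).trans (Finset.sum_le_sum fun k _ =>
        norm_noiseTermGrad_sub_le hκ hκ1 hκm k j y z)
    refine (pow_le_pow_left₀ (norm_nonneg _) h2 2).trans (sq_sum_le_card_mul_sum_sq.trans ?_)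
    gcongr
    exact_mod_cast hcard
  have hblock : ∀ k : Fin T, ∑ j, (2 * weightBound *
      (κ * ‖y - z‖ + |y (k, j) - z (k, j)|)) ^ 2 ≤ 16 * weightBound ^ 2 * ‖y - z‖ ^ 2 := fun k => by
    have h1 : ∀ j, (2 * weightBound * (κ * ‖y - z‖ + |y (k, j) - z (k, j)|)) ^ 2 ≤
        8 * weightBound ^ 2 * ((m : ℝ)⁻¹ * ‖y - z‖ ^ 2 + (y (k, j) - z (k, j)) ^ 2) := fun j => by
      have h2 : (κ * ‖y - z‖ + |y (k, j) - z (k, j)|) ^ 2 ≤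
          2 * ((m : ℝ)⁻¹ * ‖y - z‖ ^ 2 + (y (k, j) - z (k, j)) ^ 2) := by
        rw [← hκm, ← mul_pow, ← sq_abs (y (k, j) - z (k, j))]
        exact add_sq_le
      rw [mul_pow, mul_pow]
      nlinarith [sq_nonneg weightBound]
    refine (Finset.sum_le_sum fun j _ => h1 j).trans ?_
    rw [← Finset.mul_sum, Finset.sum_add_distrib, Finset.sum_const, Finset.card_univ,
      Fintype.card_fin, nsmul_eq_mul, ← mul_assoc (m : ℝ), mul_inv_cancel₀ hm0.ne', one_mul]
    have h3 : ∑ j, (y (k, j) - z (k, j)) ^ 2 ≤ ‖y - z‖ ^ 2 := by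
      rw [EuclideanSpace.real_norm_sq_eq, Fintype.sum_prod_type]
      exact Finset.single_le_sum (f := fun k => ∑ j, (y - z) (k, j) ^ 2)
        (fun i _ => Finset.sum_nonneg fun j _ => sq_nonneg _) (Finset.mem_univ k)
    nlinarith [sq_nonneg weightBound]
  rw [div_mul_eq_mul_div]
  gcongr
  calc ∑ j, ‖noiseGrad j y - noiseGrad j z‖ ^ 2
      ≤ ∑ j, 2 * ∑ k ∈ A, (2 * weightBound * (κ * ‖y - z‖ + |y (k, j) - z (k, j)|)) ^ 2 :=
        Finset.sum_le_sum fun j _ => hterm j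
    _ = 2 * ∑ k ∈ A, ∑ j, (2 * weightBound * (κ * ‖y - z‖ + |y (k, j) - z (k, j)|)) ^ 2 := by
        rw [← Finset.mul_sum, Finset.sum_comm]
    _ ≤ 2 * ∑ k ∈ A, 16 * weightBound ^ 2 * ‖y - z‖ ^ 2 := by
        gcongr with k hk
        exact hblock k
    _ ≤ 2 * (2 * (16 * weightBound ^ 2 * ‖y - z‖ ^ 2)) := by
        rw [Finset.sum_const, nsmul_eq_mul]
        gcongr
        exact_mod_cast hcard
    _ = 64 * weightBound ^ 2 * ‖y - z‖ ^ 2 := by ring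

/-! ### The mean function -/

/-- The average reward in block `k`. -/
def blockReward (k : ℕ) (y : EuclideanSpace ℝ (Fin T × Fin m)) : ℝ :=
  coordAvg m (block T m k) reward y

/-- The mean function: penalties for negative coordinates, minus the rewards of the blocks, each
multiplied by the gate of its block. The term `k = T` vanishes because there is no block `T`. -/
def chain (y : EuclideanSpace ℝ (Fin T × Fin m)) : ℝ :=
  coordAvg m Finset.univ penalty y - ∑ k ∈ Finset.range (T + 1), gate k y * blockReward k y

/-- The gradient of `chain`. -/
def chainGrad (y : EuclideanSpace ℝ (Fin T × Fin m)) : EuclideanSpace ℝ (Fin T × Fin m) :=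
  coordAvgGrad m Finset.univ (fun t => min t 0) y - ∑ k ∈ Finset.range (T + 1),
    (gate k y • coordAvgGrad m (block T m k) rewardDeriv y + blockReward k y • gateGrad k y)

theorem hasGradientAt_chain {κ : ℝ} (hκ : 0 ≤ κ) (hκm : κ ^ 2 = (m : ℝ)⁻¹)
    (y : EuclideanSpace ℝ (Fin T × Fin m)) : HasGradientAt chain (chainGrad y) y :=
  (hasGradientAt_coordAvg hasDerivAt_penalty y).sub (HasGradientAt.sum fun k _ =>
    ((isTame_gate hκ hκm k).grad y).mul (hasGradientAt_coordAvg hasDerivAt_reward y))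

theorem blockReward_nonneg (k : ℕ) (y : EuclideanSpace ℝ (Fin T × Fin m)) : 0 ≤ blockReward k y :=
  mul_nonneg (by positivity) (Finset.sum_nonneg fun _ _ => reward_nonneg _)

theorem blockReward_le_one (k : ℕ) (y : EuclideanSpace ℝ (Fin T × Fin m)) : blockReward k y ≤ 1 :=
  (le_abs_self _).trans (abs_coordAvg_le (card_block_le k) zero_le_one abs_reward_le y)

theorem blockReward_last (y : EuclideanSpace ℝ (Fin T × Fin m)) : blockReward T y = 0 := by
  have : block T m T = ∅ := by
    ext a
    simp [block, a.1.2.ne]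
  simp [blockReward, coordAvg, this]

/-- A coordinate influences `chain` through its penalty, its reward, and the gate of the next
block. -/
theorem chainGrad_apply (y : EuclideanSpace ℝ (Fin T × Fin m)) (a : Fin T × Fin m) :
    chainGrad y a = (m : ℝ)⁻¹ * (min (y a) 0 - gate a.1 y * rewardDeriv (y a) -
      blockReward (a.1 + 1) y * gateSlope (a.1 + 1) y * markDeriv (y a)) := by
  have h1 : ∀ k, (gate k y • coordAvgGrad m (block T m k) rewardDeriv y +
      blockReward k y • gateGrad k y) a =
      (if (a.1 : ℕ) = k then gate k y * ((m : ℝ)⁻¹ * rewardDeriv (y a)) else 0) +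
      (if (a.1 : ℕ) + 1 = k then
        blockReward k y * (gateSlope k y * ((m : ℝ)⁻¹ * markDeriv (y a))) else 0) := fun k => by
    simp [coordAvgGrad, gateGrad, block, prevBlock]
  have h2 : chainGrad y a = (m : ℝ)⁻¹ * min (y a) 0 - ∑ k ∈ Finset.range (T + 1),
      (gate k y • coordAvgGrad m (block T m k) rewardDeriv y +
      blockReward k y • gateGrad k y) a := by
    simp [chainGrad, coordAvgGrad]
  rw [h2, Finset.sum_congr rfl fun k _ => h1 k, Finset.sum_add_distrib, Finset.sum_ite_eq,
    Finset.sum_ite_eq, if_pos (by simp), if_pos (by simp)]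
  ring

/-- Summing over `a` the averages of `D` over at most `m`-to-one related coordinates. -/
theorem sum_inv_mul_sum_filter_le {ι : Type*} [Fintype ι] (m : ℕ) (P : ι → ι → Prop)
    [∀ a b, Decidable (P a b)]
    (hP : ∀ b, (Finset.univ.filter fun a => P a b).card ≤ m) (D : ι → ℝ) (hD : ∀ b, 0 ≤ D b) :
    ∑ a, (m : ℝ)⁻¹ * ∑ b ∈ Finset.univ.filter (P a), D b ≤ ∑ b, D b := by
  rw [← Finset.mul_sum]
  simp_rw [Finset.sum_filter]
  rw [Finset.sum_comm, Finset.mul_sum]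
  refine Finset.sum_le_sum fun b _ => ?_
  rw [← Finset.sum_filter, Finset.sum_const, nsmul_eq_mul]
  rcases Nat.eq_zero_or_pos m with rfl | hm
  · simpa using hD b
  have hm' : (0 : ℝ) < m := by exact_mod_cast hm
  rw [inv_mul_le_iff₀ hm']
  exact mul_le_mul_of_nonneg_right (by exact_mod_cast hP b) (hD b)

/-- A bound for the squared Lipschitz constant of `chainGrad`, times `m ^ 2`. -/
def chainBound : ℝ := 10 ^ 9

/-- Each coordinate of `chainGrad` is `1 / m` times a Lipschitz function of its own coordinate and
of averages over its own block and the two adjacent ones; hence the Lipschitz constant is of order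
`1 / m`, independently of the number of blocks. -/
theorem norm_chainGrad_sub_sq_le (hm : 1 ≤ m) (y z : EuclideanSpace ℝ (Fin T × Fin m)) :
    ‖chainGrad y - chainGrad z‖ ^ 2 ≤ chainBound / m ^ 2 * ‖y - z‖ ^ 2 := by
  have hm0 : (0 : ℝ) < m := by exact_mod_cast hm
  set D : Fin T × Fin m → ℝ := fun b => (y b - z b) ^ 2 with hD
  have hD0 : ∀ b, 0 ≤ D b := fun b => sq_nonneg _
  have hunlock : ∀ k, (unlock k y - unlock k z) ^ 2 ≤
      36 * ((m : ℝ)⁻¹ * ∑ b ∈ prevBlock T m k, D b) := fun k => by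
    have h1 := coordAvg_sub_sq_le (card_prevBlock_le (T := T) (m := m) k) (φ := mark) (B := 6)
      (fun t x => by
        have h := Convex.norm_image_sub_le_of_norm_hasDerivWithin_le (f := mark)
          (f' := markDeriv) (s := Set.univ) (x := x) (y := t) (C := 6)
          (fun y _ => (hasDerivAt_mark y).hasDerivWithinAt) (fun y _ => abs_markDeriv_le y)
          convex_univ (Set.mem_univ _) (Set.mem_univ _)
        simpa only [Real.norm_eq_abs] using h) y z
    have h2 : unlock k y - unlock k z =
        coordAvg m (prevBlock T m k) mark y - coordAvg m (prevBlock T m k) mark z := by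
      simp [unlock]
    rw [h2]
    linarith
  have hreward : ∀ k, (blockReward k y - blockReward k z) ^ 2 ≤
      (m : ℝ)⁻¹ * ∑ b ∈ block T m k, D b := fun k => by
    have h1 := coordAvg_sub_sq_le (card_block_le (T := T) (m := m) k) (φ := reward) (B := 1)
      (fun t x => by rw [one_mul]; exact abs_reward_sub_le t x) y z
    simpa [blockReward, hD] using h1
  have hgate : ∀ k, |gate k y - gate k z| ≤ 12 * |unlock k y - unlock k z| := fun k => by
    have := abs_smoothstep_sub_le (8 * unlock k y - 6) (8 * unlock k z - 6)
    rw [show 8 * unlock k y - 6 - (8 * unlock k z - 6) = 8 * (unlock k y - unlock k z) by ring,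
      abs_mul, abs_of_pos (by norm_num : (0 : ℝ) < 8)] at this
    unfold gate
    linarith
  have hpoint : ∀ a, (chainGrad y a - chainGrad z a) ^ 2 ≤ (m : ℝ)⁻¹ ^ 2 * (4 * (794 ^ 2 * D a +
      144 * (36 * ((m : ℝ)⁻¹ * ∑ b ∈ prevBlock T m a.1, D b)) +
      5184 * ((m : ℝ)⁻¹ * ∑ b ∈ block T m (a.1 + 1), D b) +
      2304 ^ 2 * (36 * ((m : ℝ)⁻¹ * ∑ b ∈ prevBlock T m (a.1 + 1), D b)))) := fun a => by
    rw [chainGrad_apply, chainGrad_apply, ← mul_sub, mul_pow]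
    gcongr
    set k : ℕ := a.1.val
    have e1 := hgate k
    have e2 : |gateSlope (k + 1) y - gateSlope (k + 1) z| ≤
        384 * |unlock (k + 1) y - unlock (k + 1) z| := abs_gateProfileDeriv_sub_le _ _
    have e3 : |gateSlope (k + 1) y| ≤ 12 := abs_gateProfileDeriv_le _
    have e4 : |gateSlope (k + 1) z| ≤ 12 := abs_gateProfileDeriv_le _
    have e5 : |blockReward (k + 1) z| ≤ 1 := by
      rw [abs_of_nonneg (blockReward_nonneg _ _)]
      exact blockReward_le_one _ _
    have e6 : |gate k z| ≤ 1 := by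
      rw [abs_of_nonneg (gate_nonneg _ _)]
      exact gate_le_one _ _
    have e7 : |min (y a) 0 - min (z a) 0| ≤ |y a - z a| := by
      simpa using abs_min_sub_min_le_max (y a) 0 (z a) 0
    have e8 := abs_rewardDeriv_le (y a)
    have e9 := abs_rewardDeriv_sub_le (y a) (z a)
    have e10 := abs_markDeriv_le (y a)
    have e11 := abs_markDeriv_sub_le (y a) (z a)
    set δ := |y a - z a| with hδ
    set δU := |unlock k y - unlock k z| with hδU
    set δU' := |unlock (k + 1) y - unlock (k + 1) z| with hδU'
    set δv := |blockReward (k + 1) y - blockReward (k + 1) z| with hδv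
    have hδ0 : 0 ≤ δ := abs_nonneg _
    have hδU0 : 0 ≤ δU := abs_nonneg _
    have hδU0' : 0 ≤ δU' := abs_nonneg _
    have hδv0 : 0 ≤ δv := abs_nonneg _
    have f1 : |(gate k y - gate k z) * rewardDeriv (y a)| ≤ 12 * δU * 1 := by
      rw [abs_mul]
      exact mul_le_mul e1 e8 (abs_nonneg _) (by positivity)
    have f2 : |gate k z * (rewardDeriv (y a) - rewardDeriv (z a))| ≤ 1 * δ := by
      rw [abs_mul]
      exact mul_le_mul e6 e9 (abs_nonneg _) zero_le_one
    have f3 : |(blockReward (k + 1) y - blockReward (k + 1) z) * gateSlope (k + 1) y *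
        markDeriv (y a)| ≤ δv * 12 * 6 := by
      rw [abs_mul, abs_mul]
      exact mul_le_mul (mul_le_mul le_rfl e3 (abs_nonneg _) hδv0) e10 (abs_nonneg _)
        (by positivity)
    have f4 : |blockReward (k + 1) z * (gateSlope (k + 1) y - gateSlope (k + 1) z) *
        markDeriv (y a)| ≤ 1 * (384 * δU') * 6 := by
      rw [abs_mul, abs_mul]
      exact mul_le_mul (mul_le_mul e5 e2 (abs_nonneg _) zero_le_one) e10 (abs_nonneg _)
        (by positivity)
    have f5 : |blockReward (k + 1) z * gateSlope (k + 1) z *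
        (markDeriv (y a) - markDeriv (z a))| ≤ 1 * 12 * (66 * δ) := by
      rw [abs_mul, abs_mul]
      exact mul_le_mul (mul_le_mul e5 e4 (abs_nonneg _) zero_le_one) e11 (abs_nonneg _)
        (by norm_num)
    have hsum : |min (y a) 0 - gate k y * rewardDeriv (y a) -
        blockReward (k + 1) y * gateSlope (k + 1) y * markDeriv (y a) -
        (min (z a) 0 - gate k z * rewardDeriv (z a) -
        blockReward (k + 1) z * gateSlope (k + 1) z * markDeriv (z a))| ≤
        794 * δ + 12 * δU + 72 * δv + 2304 * δU' := by
      rw [abs_le] at e7 f1 f2 f3 f4 f5 ⊢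
      constructor <;> linarith
    have hsq := pow_le_pow_left₀ (abs_nonneg _) hsum 2
    rw [sq_abs] at hsq
    have g1 : D a = δ ^ 2 := (sq_abs _).symm
    have g2 := hunlock k
    have g3 := hreward (k + 1)
    have g4 := hunlock (k + 1)
    rw [← sq_abs, ← hδU] at g2
    rw [← sq_abs, ← hδv] at g3
    rw [← sq_abs, ← hδU'] at g4
    rw [g1]
    refine hsq.trans ?_
    have g5 : (794 * δ + 12 * δU + 72 * δv + 2304 * δU') ^ 2 ≤
        4 * ((794 * δ) ^ 2 + (12 * δU) ^ 2 + (72 * δv) ^ 2 + (2304 * δU') ^ 2) := by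
      linarith [sq_nonneg (794 * δ - 12 * δU), sq_nonneg (794 * δ - 72 * δv),
        sq_nonneg (794 * δ - 2304 * δU'), sq_nonneg (12 * δU - 72 * δv),
        sq_nonneg (12 * δU - 2304 * δU'), sq_nonneg (72 * δv - 2304 * δU')]
    rw [mul_pow, mul_pow, mul_pow, mul_pow] at g5
    linarith
  rw [EuclideanSpace.real_norm_sq_eq, EuclideanSpace.real_norm_sq_eq]
  have s1 := sum_inv_mul_sum_filter_le m (fun a b : Fin T × Fin m => (b.1 : ℕ) + 1 = a.1)
    (fun b => card_le_of_fst_eq fun a ha c hc => by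
      simp only [Finset.mem_filter, Finset.mem_univ, true_and] at ha hc
      exact Fin.ext (ha.symm.trans hc)) D hD0
  have s2 := sum_inv_mul_sum_filter_le m (fun a b : Fin T × Fin m => (b.1 : ℕ) = a.1 + 1)
    (fun b => card_le_of_fst_eq fun a ha c hc => by
      simp only [Finset.mem_filter, Finset.mem_univ, true_and] at ha hc
      exact Fin.ext (by omega)) D hD0
  have s3 := sum_inv_mul_sum_filter_le m (fun a b : Fin T × Fin m => (b.1 : ℕ) + 1 = a.1 + 1)
    (fun b => card_le_of_fst_eq fun a ha c hc => by
      simp only [Finset.mem_filter, Finset.mem_univ, true_and] at ha hc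
      exact Fin.ext (by omega)) D hD0
  calc ∑ a, (chainGrad y - chainGrad z) a ^ 2
      ≤ ∑ a, (m : ℝ)⁻¹ ^ 2 * (4 * (794 ^ 2 * D a +
        144 * (36 * ((m : ℝ)⁻¹ * ∑ b ∈ prevBlock T m a.1, D b)) +
        5184 * ((m : ℝ)⁻¹ * ∑ b ∈ block T m (a.1 + 1), D b) +
        2304 ^ 2 * (36 * ((m : ℝ)⁻¹ * ∑ b ∈ prevBlock T m (a.1 + 1), D b)))) :=
        Finset.sum_le_sum fun a _ => hpoint a
    _ = (m : ℝ)⁻¹ ^ 2 * (4 * (794 ^ 2 * ∑ a, D a +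
        144 * (36 * ∑ a : Fin T × Fin m, (m : ℝ)⁻¹ * ∑ b ∈ prevBlock T m a.1, D b) +
        5184 * ∑ a : Fin T × Fin m, (m : ℝ)⁻¹ * ∑ b ∈ block T m (a.1 + 1), D b +
        2304 ^ 2 * (36 * ∑ a : Fin T × Fin m, (m : ℝ)⁻¹ *
          ∑ b ∈ prevBlock T m (a.1 + 1), D b))) := by
        simp only [← Finset.mul_sum, Finset.sum_add_distrib]
    _ ≤ (m : ℝ)⁻¹ ^ 2 * (chainBound * ∑ a, D a) := by
        refine mul_le_mul_of_nonneg_left ?_ (by positivity)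
        have s0 : 0 ≤ ∑ a, D a := Finset.sum_nonneg fun a _ => hD0 a
        unfold chainBound
        change ∑ a : Fin T × Fin m, (m : ℝ)⁻¹ * ∑ b ∈ prevBlock T m a.1, D b ≤ _ at s1
        change ∑ a : Fin T × Fin m, (m : ℝ)⁻¹ * ∑ b ∈ block T m (a.1 + 1), D b ≤ _ at s2
        change ∑ a : Fin T × Fin m, (m : ℝ)⁻¹ * ∑ b ∈ prevBlock T m (a.1 + 1), D b ≤ _ at s3
        linarith
    _ = _ := by
        rw [div_eq_mul_inv, inv_pow]
        simp only [hD, PiLp.sub_apply]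
        ring

theorem isNoiseModel_chain (hm : 1 ≤ m) :
    IsNoiseModel (chain (T := T) (m := m)) chainGrad noise noiseGrad
      (chainBound / m ^ 2) (64 * weightBound ^ 2 / m) (4 * weightBound ^ 2) := by
  have hm0 : (1 : ℝ) ≤ m := by exact_mod_cast hm
  have hκ : 0 ≤ (√(m : ℝ))⁻¹ := by positivity
  have hκ1 : (√(m : ℝ))⁻¹ ≤ 1 := inv_le_one_of_one_le₀ (Real.one_le_sqrt.mpr hm0)
  have hκm : (√(m : ℝ))⁻¹ ^ 2 = (m : ℝ)⁻¹ := by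
    rw [inv_pow, Real.sq_sqrt (by positivity)]
  exact ⟨fun y => hasGradientAt_chain hκ hκm y, fun j y => hasGradientAt_noise hκ hκm j y,
    norm_chainGrad_sub_sq_le hm, sum_norm_noiseGrad_sub_sq_le hκ hκ1 hκm hm,
    sum_norm_noiseGrad_sq_le hκ hκ1 hκm hm⟩

theorem coordAvg_block_of_forall_eq (hm : 1 ≤ m) (k : Fin T) {φ : ℝ → ℝ} {c : ℝ}
    {y : EuclideanSpace ℝ (Fin T × Fin m)} (h : ∀ a, φ (y a) = c) :
    coordAvg m (block T m k) φ y = c := by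
  have hm0 : (m : ℝ) ≠ 0 := by positivity
  simp only [coordAvg, h, Finset.sum_const, card_block, nsmul_eq_mul]
  field_simp

/-- At the origin only the gate of the first block is open, and its rewards are `1 / 2`. -/
theorem chain_zero (hT : 1 ≤ T) (hm : 1 ≤ m) :
    chain (0 : EuclideanSpace ℝ (Fin T × Fin m)) = -(1 / 2) := by
  have hr : reward 0 = 1 / 2 := by
    norm_num [reward, smoothstep]
  have h0 : ∀ k ∈ Finset.range (T + 1), k ≠ 0 →
      gate k (0 : EuclideanSpace ℝ (Fin T × Fin m)) *
      blockReward k (0 : EuclideanSpace ℝ (Fin T × Fin m)) = 0 := fun k _ hk => by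
    rw [gate_eq_zero, zero_mul]
    norm_num [unlock, coordAvg, mark_zero, hk]
  have h1 : gate 0 (0 : EuclideanSpace ℝ (Fin T × Fin m)) = 1 :=
    gate_eq_one (by norm_num [unlock, coordAvg, mark_zero])
  have h2 : blockReward 0 (0 : EuclideanSpace ℝ (Fin T × Fin m)) = 1 / 2 :=
    coordAvg_block_of_forall_eq hm ⟨0, hT⟩ fun a => hr
  rw [chain, Finset.sum_eq_single 0 h0 (by simp), h1, h2]
  simp [coordAvg, penalty]

theorem neg_le_chain (y : EuclideanSpace ℝ (Fin T × Fin m)) : -(T : ℝ) ≤ chain y := by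
  have h1 : 0 ≤ coordAvg m Finset.univ penalty y :=
    mul_nonneg (by positivity) (Finset.sum_nonneg fun _ _ => by unfold penalty; positivity)
  have h2 : ∑ k ∈ Finset.range (T + 1), gate k y * blockReward k y ≤ T := by
    rw [Finset.sum_range_succ, blockReward_last, mul_zero, add_zero]
    refine (Finset.sum_le_card_nsmul _ _ 1 fun k _ => ?_).trans (by simp)
    exact mul_le_one₀ (gate_le_one k y) (blockReward_nonneg k y) (blockReward_le_one k y)
  unfold chain
  linarith

/-- The lower bound `-T` is attained where all coordinates equal `2`. -/
theorem exists_chain_eq (hm : 1 ≤ m) : ∃ y : EuclideanSpace ℝ (Fin T × Fin m), chain y = -T := by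
  set y : EuclideanSpace ℝ (Fin T × Fin m) := WithLp.toLp 2 fun _ => 2 with hy
  have hya : ∀ a, y a = 2 := fun a => rfl
  refine ⟨y, ?_⟩
  have h1 : ∀ k ∈ Finset.range T, gate k y * blockReward k y = 1 := fun k hk => by
    rw [Finset.mem_range] at hk
    have h2 : blockReward k y = 1 := coordAvg_block_of_forall_eq hm ⟨k, hk⟩ fun a => by
      rw [hya, reward, smoothstep_of_one_le (by norm_num)]
    have h3 : unlock k y = 1 := by
      rcases Nat.eq_zero_or_pos k with rfl | hk0
      · simp [unlock, prevBlock_zero, coordAvg]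
      · obtain ⟨l, rfl⟩ := Nat.exists_eq_succ_of_ne_zero hk0.ne'
        rw [unlock, if_neg (by omega), zero_add, Nat.succ_eq_add_one, prevBlock_succ]
        exact coordAvg_block_of_forall_eq hm ⟨l, by omega⟩ fun a => by
          rw [hya, mark_of_one_le (by norm_num)]
    rw [h2, gate_eq_one (by rw [h3]; norm_num), one_mul]
  rw [chain, Finset.sum_range_succ, blockReward_last, mul_zero, add_zero,
    Finset.sum_congr rfl h1]
  simp [coordAvg, penalty, hya]

/-! ### Hidden coordinates -/

/-- The points that are supported in the blocks before block `k` and in the coordinates `J` of block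
`k`. -/
def knownSubspace (T : ℕ) {m : ℕ} (k : ℕ) (J : Finset (Fin m)) :
    Submodule ℝ (EuclideanSpace ℝ (Fin T × Fin m)) where
  carrier := {y | ∀ a : Fin T × Fin m, k < a.1.val ∨ (a.1.val = k ∧ a.2 ∉ J) → y a = 0}
  zero_mem' := fun a _ => rfl
  add_mem' := fun hy hz a ha => by simp [hy a ha, hz a ha]
  smul_mem' := fun c y hy a ha => by simp [hy a ha]

theorem knownSubspace_mono {k : ℕ} {J J' : Finset (Fin m)} (h : J ⊆ J') :
    knownSubspace T k J ≤ knownSubspace T k J' := fun _ hy a ha =>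
  hy a (ha.imp_right fun h' => ⟨h'.1, fun hJ => h'.2 (h hJ)⟩)

theorem knownSubspace_le_succ (k : ℕ) (J J' : Finset (Fin m)) :
    knownSubspace T k J ≤ knownSubspace T (k + 1) J' := fun _ hy a ha =>
  hy a (Or.inl (by omega))

section Known

variable {k : ℕ} {J : Finset (Fin m)} {y : EuclideanSpace ℝ (Fin T × Fin m)}

/-- While at most half of block `k` is known, the marks in block `k` and later average to at most
`1 / 2`. -/
theorem coordAvg_laterBlocks_le (hy : y ∈ knownSubspace T k J) (hJ : 2 * J.card ≤ m) :
    coordAvg m (laterBlocks T m k) mark y ≤ 1 / 2 := by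
  rcases Nat.eq_zero_or_pos m with rfl | hm
  · norm_num [coordAvg]
  have hm0 : (0 : ℝ) < m := by exact_mod_cast hm
  set s := (block T m k).filter fun a => a.2 ∈ J with hs
  have hcard : s.card ≤ J.card := Finset.card_le_card_of_injOn Prod.snd
    (fun a ha => (Finset.mem_filter.mp ha).2) (fun a ha b hb hab => by
      have ha' := (Finset.mem_filter.mp (Finset.mem_filter.mp ha).1).2
      have hb' := (Finset.mem_filter.mp (Finset.mem_filter.mp hb).1).2
      exact Prod.ext (Fin.ext (ha'.trans hb'.symm)) hab)
  have hsum : ∑ a ∈ laterBlocks T m k, mark (y a) = ∑ a ∈ s, mark (y a) := by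
    refine (Finset.sum_subset (fun a ha => ?_) fun a ha ha' => ?_).symm
    · have := (Finset.mem_filter.mp (Finset.mem_filter.mp ha).1).2
      exact Finset.mem_filter.mpr ⟨Finset.mem_univ _, this.ge⟩
    · have h1 : k ≤ a.1.val := (Finset.mem_filter.mp ha).2
      rw [hy a, mark_zero]
      rcases h1.lt_or_eq with h | h
      · exact Or.inl h
      · exact Or.inr ⟨h.symm, fun hJ => ha' (Finset.mem_filter.mpr
          ⟨Finset.mem_filter.mpr ⟨Finset.mem_univ _, h.symm⟩, hJ⟩)⟩
  rw [coordAvg, hsum, inv_mul_le_iff₀ hm0]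
  refine (Finset.sum_le_card_nsmul _ _ 1 fun a _ => mark_le_one _).trans ?_
  rw [nsmul_eq_mul, mul_one]
  have h1 : (s.card : ℝ) ≤ J.card := by exact_mod_cast hcard
  have h2 : 2 * (J.card : ℝ) ≤ m := by exact_mod_cast hJ
  linarith

theorem unlock_le_half (hy : y ∈ knownSubspace T k J) (hJ : 2 * J.card ≤ m) {l : ℕ} (hl : k < l) :
    unlock l y ≤ 1 / 2 := (unlock_le_of_lt hl y).trans (coordAvg_laterBlocks_le hy hJ)

theorem weightGrad_apply_eq_zero {l : ℕ} {a : Fin T × Fin m} (ha : y a = 0) :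
    weightGrad l y a = 0 := by
  simp [weightGrad, quietGrad, gateGrad, coordAvgGrad, ha, markDeriv_zero]

/-- Away from the coordinate `(k, j)`, the noise gradients do not leave the known subspace. -/
theorem noiseGrad_apply (hy : y ∈ knownSubspace T k J) (j : Fin m) {a : Fin T × Fin m}
    (ha : k < a.1.val ∨ (a.1.val = k ∧ a.2 ∉ J)) :
    noiseGrad j y a = if a.2 = j then weight a.1 y * rewardDeriv 0 else 0 := by
  have h0 : y a = 0 := hy a ha
  have h1 : ∀ l : Fin T, noiseTermGrad l j y a =
      if l = a.1 then (if a.2 = j then weight a.1 y * rewardDeriv 0 else 0) else 0 := fun l => by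
    obtain ⟨i, j'⟩ := a
    simp only [noiseTermGrad, PiLp.add_apply, PiLp.smul_apply, weightGrad_apply_eq_zero h0,
      smul_eq_mul, mul_zero, add_zero, PiLp.single_apply, Prod.mk.injEq]
    by_cases hl : l = i
    · subst hl
      by_cases hj : j' = j
      · subst hj
        simp [h0]
      · simp [hj]
    · simp [hl, Ne.symm hl]
  rw [noiseGrad, WithLp.ofLp_sum, Finset.sum_apply, Finset.sum_congr rfl fun l _ => h1 l]
  simp

theorem weight_eq_zero_of_lt (hy : y ∈ knownSubspace T k J) (hJ : 2 * J.card ≤ m) {l : ℕ}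
    (hl : k < l) : weight l y = 0 := by
  rw [weight, gate_eq_zero ((unlock_le_half hy hJ hl).trans (by norm_num)), zero_mul]

theorem weight_eq_gate (hy : y ∈ knownSubspace T k J) (hJ : 2 * J.card ≤ m) :
    weight k y = gate k y := by
  have := coordAvg_laterBlocks_le hy hJ
  rw [weight, quiet, smoothstep_of_nonpos (by linarith), sub_zero, mul_one]

theorem noiseGrad_mem (hy : y ∈ knownSubspace T k J) (hJ : 2 * J.card ≤ m) (j : Fin m) :
    noiseGrad j y ∈ knownSubspace T k (insert j J) := fun a ha => by
  have ha' : k < a.1.val ∨ (a.1.val = k ∧ a.2 ∉ J) :=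
    ha.imp_right fun h => ⟨h.1, fun h' => h.2 (Finset.mem_insert_of_mem h')⟩
  rw [noiseGrad_apply hy j ha']
  rcases ha with h | ⟨-, h⟩
  · rw [weight_eq_zero_of_lt hy hJ h, zero_mul, ite_self]
  · exact if_neg fun hj => h (Finset.mem_insert.mpr (Or.inl hj))

/-- The part of a stochastic gradient that is common to all components reveals nothing: in the
unknown part of block `k`, the reward in the mean function and the average noise cancel. -/
theorem chainGrad_add_mem (hy : y ∈ knownSubspace T k J) (hJ : 2 * J.card ≤ m) :
    chainGrad y + (m : ℝ)⁻¹ • ∑ j, noiseGrad j y ∈ knownSubspace T k J := fun a ha => by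
  have h0 : y a = 0 := hy a ha
  have h1 : (∑ j, noiseGrad j y) a = weight a.1 y * rewardDeriv 0 := by
    rw [WithLp.ofLp_sum, Finset.sum_apply, Finset.sum_congr rfl fun j _ => noiseGrad_apply hy j ha]
    simp
  have h2 : weight a.1 y = gate a.1 y := by
    rcases ha with h | ⟨h, -⟩
    · rw [weight_eq_zero_of_lt hy hJ h,
        gate_eq_zero ((unlock_le_half hy hJ h).trans (by norm_num))]
    · rw [h]
      exact weight_eq_gate hy hJ
  rw [PiLp.add_apply, PiLp.smul_apply, h1, h2, chainGrad_apply, h0, markDeriv_zero]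
  simp

/-- As long as at most half of some block `k < T` is known, the gradient is large: in the first
block that fails to unlock its successor, a fixed fraction of the coordinates is less than `1`, and
each of them contributes a definite amount. -/
theorem le_norm_chainGrad (hm : 1 ≤ m) (hk : k < T) (hy : y ∈ knownSubspace T k J)
    (hJ : 2 * J.card ≤ m) : (√(m : ℝ))⁻¹ / 12 ≤ ‖chainGrad y‖ := by
  classical
  have hm0 : (0 : ℝ) < m := by exact_mod_cast hm
  have hex : ∃ l, unlock (l + 1) y < 7 / 8 :=
    ⟨k, (unlock_le_half hy hJ k.lt_succ_self).trans_lt (by norm_num)⟩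
  -- Block `i` is the first one that does not fully unlock its successor; its own gate is open.
  set i := Nat.find hex with hi
  have hi1 : unlock (i + 1) y < 7 / 8 := Nat.find_spec hex
  have hik : i ≤ k := Nat.find_min' hex ((unlock_le_half hy hJ k.lt_succ_self).trans_lt
    (by norm_num))
  have hi2 : gate i y = 1 := by
    refine gate_eq_one ?_
    rcases Nat.eq_zero_or_pos i with h | h
    · rw [h, unlock, if_pos rfl, prevBlock_zero]
      norm_num [coordAvg]
    · obtain ⟨l, hl⟩ := Nat.exists_eq_succ_of_ne_zero h.ne'
      have := Nat.find_min hex (m := l) (by omega)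
      rw [hl]
      exact not_lt.mp this
  set s := (block T m i).filter fun a => y a < 1 with hs
  -- coordinates at `1` or beyond have mark `1`, and the marks average to less than `7 / 8`
  have hcard : (m : ℝ) / 8 ≤ s.card := by
    have h1 : (block T m i).card = m := card_block ⟨i, by omega⟩
    have h2 := Finset.card_filter_add_card_filter_not (s := block T m i) (fun a => y a < 1)
    rw [h1, ← hs] at h2
    set s' := (block T m i).filter fun a => ¬ y a < 1 with hs'
    have h3 : (s'.card : ℝ) ≤ ∑ a ∈ block T m i, mark (y a) := by
      calc (s'.card : ℝ) = ∑ a ∈ s', mark (y a) := by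
            rw [Finset.sum_congr rfl fun a ha => mark_of_one_le
              (not_lt.mp (Finset.mem_filter.mp ha).2),
              Finset.sum_const, nsmul_eq_mul, mul_one]
        _ ≤ _ := Finset.sum_le_sum_of_subset_of_nonneg (Finset.filter_subset _ _)
            fun _ _ _ => mark_nonneg _
    rw [unlock, if_neg (by omega), zero_add, prevBlock_succ, coordAvg, inv_mul_lt_iff₀ hm0] at hi1
    have h4 : (s.card : ℝ) + s'.card = m := by exact_mod_cast h2
    linarith
  have hcoord : ∀ a ∈ s, (m : ℝ)⁻¹ / 4 ≤ |chainGrad y a| := fun a ha => by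
    have ha1 : a.1.val = i := (Finset.mem_filter.mp (Finset.mem_filter.mp ha).1).2
    have ha2 : y a < 1 := (Finset.mem_filter.mp ha).2
    rw [chainGrad_apply, ha1, hi2, abs_mul, abs_of_pos (inv_pos.mpr hm0), div_eq_mul_inv]
    refine mul_le_mul_of_nonneg_left ?_ (inv_pos.mpr hm0).le
    have h1 : 0 ≤ blockReward (i + 1) y * gateSlope (i + 1) y * markDeriv (y a) :=
      mul_nonneg (mul_nonneg (blockReward_nonneg _ _) (gateSlope_nonneg _ _)) (markDeriv_nonneg _)
    have h2 := rewardDeriv_nonneg (y a)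
    -- the reward pushes to the right on `[-1, 1]`, the penalty to the left of `-1`
    have h3 : min (y a) 0 - rewardDeriv (y a) ≤ -(1 / 4) := by
      rcases le_total (-1) (y a) with h | h
      · linarith [le_rewardDeriv h ha2.le, min_le_right (y a) 0]
      · linarith [min_le_left (y a) 0]
    rw [le_abs]
    right
    linarith
  refine le_of_sq_le_sq ?_ (norm_nonneg _)
  rw [EuclideanSpace.real_norm_sq_eq, div_pow, inv_pow, Real.sq_sqrt hm0.le]
  calc (m : ℝ)⁻¹ / 12 ^ 2 ≤ m / 8 * ((m : ℝ)⁻¹ / 4) ^ 2 := by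
        rw [div_pow, ← mul_div_mul_comm, sq (m : ℝ)⁻¹, ← mul_assoc, mul_inv_cancel₀ hm0.ne',
          one_mul]
        gcongr
        norm_num
    _ ≤ s.card * ((m : ℝ)⁻¹ / 4) ^ 2 := by gcongr
    _ = ∑ a ∈ s, ((m : ℝ)⁻¹ / 4) ^ 2 := by simp
    _ ≤ ∑ a ∈ s, chainGrad y a ^ 2 := Finset.sum_le_sum fun a ha => by
        rw [← sq_abs (chainGrad y a)]
        exact pow_le_pow_left₀ (by positivity) (hcoord a ha) 2
    _ ≤ ∑ a, chainGrad y a ^ 2 := Finset.sum_le_sum_of_subset_of_nonneg (Finset.subset_univ _)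
        fun _ _ _ => sq_nonneg _

end Known

/-- Each query reveals at most one coordinate of the current block, and a block counts as known
once more than half of it could be, that is, after `(m + 1) / 2` queries. -/
theorem hidesGradient_chain (hm : 1 ≤ m) :
    HidesGradient (chainGrad (T := T) (m := m)) noiseGrad
      (fun t V => ∃ (k : ℕ) (J : Finset (Fin m)), J.card < (m + 1) / 2 ∧
        k * ((m + 1) / 2) + J.card ≤ t ∧ V = knownSubspace T k J)
      (T * ((m + 1) / 2)) ((√(m : ℝ))⁻¹ / 12) where
  start := ⟨_, 0, ∅, by simp; omega, by simp, rfl⟩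
  common_mem := by
    rintro t _ ⟨k, J, hJ, -, rfl⟩ y hy
    exact chainGrad_add_mem hy (by omega)
  step := by
    rintro t _ ⟨k, J, hJ, ht, rfl⟩ y hy j
    have hmem := noiseGrad_mem hy (by omega) j
    have hcard := Finset.card_insert_le j J
    by_cases h : (insert j J).card < (m + 1) / 2
    · exact ⟨_, knownSubspace_mono (Finset.subset_insert _ _),
        ⟨k, insert j J, h, by omega, rfl⟩, hmem⟩
    · refine ⟨_, knownSubspace_le_succ k J ∅, ⟨k + 1, ∅, by simp; omega, ?_, rfl⟩,
        knownSubspace_le_succ k (insert j J) ∅ hmem⟩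
      rw [add_mul, Finset.card_empty]
      omega
  le_norm := by
    rintro t ht _ ⟨k, J, hJ, hkt, rfl⟩ y hy
    have hkT : k < T := by
      by_contra! hc
      have := Nat.mul_le_mul_right ((m + 1) / 2) hc
      omega
    exact le_norm_chainGrad hm hkT hy (by omega)

end Chain

/-! ### Linear noise on a quadratic -/

section Quadratic

variable {m : ℕ} {ℓ a : ℝ}

/-- The mean `ℓ / 2 ‖y‖ ^ 2 - (a / m) ∑ j, y j` on a single block, written as an average. -/
def quadratic (m : ℕ) (ℓ a : ℝ) : EuclideanSpace ℝ (Fin 1 × Fin m) → ℝ :=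
  coordAvg m Finset.univ fun t => m * ℓ / 2 * t ^ 2 - a * t

/-- The gradient of `quadratic`. -/
def quadraticGrad (m : ℕ) (ℓ a : ℝ) :
    EuclideanSpace ℝ (Fin 1 × Fin m) → EuclideanSpace ℝ (Fin 1 × Fin m) :=
  coordAvgGrad m Finset.univ fun t => m * ℓ * t - a

theorem quadraticGrad_apply (hm : 1 ≤ m) (y : EuclideanSpace ℝ (Fin 1 × Fin m))
    (b : Fin 1 × Fin m) : quadraticGrad m ℓ a y b = ℓ * y b - (m : ℝ)⁻¹ * a := by
  have hm0 : (m : ℝ) ≠ 0 := by positivity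
  simp [quadraticGrad, coordAvgGrad, mul_sub]
  field_simp

theorem isNoiseModel_quadratic (hm : 1 ≤ m) :
    IsNoiseModel (quadratic m ℓ a) (quadraticGrad m ℓ a) (fun j y => a * y (0, j))
      (fun j _ => a • EuclideanSpace.single ((0 : Fin 1), j) (1 : ℝ)) (ℓ ^ 2) 0 (a ^ 2) where
  grad_mean y := hasGradientAt_coordAvg (fun t => by
    have h1 := ((hasDerivAt_id t).pow 2).const_mul (m * ℓ / 2)
    have h2 := (hasDerivAt_id t).const_mul a
    refine (h1.sub h2).congr_deriv ?_
    simp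
    ring) y
  grad_noise j y := hasGradientAt_coord (φ := fun t => a * t) (0, j) (by
    simpa using (hasDerivAt_id (y (0, j))).const_mul a)
  smooth_mean y z := by
    rw [EuclideanSpace.real_norm_sq_eq, EuclideanSpace.real_norm_sq_eq, Finset.mul_sum]
    refine Finset.sum_le_sum fun b _ => le_of_eq ?_
    rw [PiLp.sub_apply, PiLp.sub_apply, quadraticGrad_apply hm, quadraticGrad_apply hm]
    ring
  smooth_noise y z := by simp
  second_moment y := by
    have hm0 : (m : ℝ) ≠ 0 := by positivity
    simp [norm_smul]
    field_simp
    exact le_rfl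

/-- A query reveals only the coordinate of its own component, and every hidden coordinate of the
mean gradient is `-a / m`. -/
theorem hidesGradient_quadratic (hm : 1 ≤ m) {γ : ℝ} (ha : γ ^ 2 * (2 * m) ≤ a ^ 2) :
    HidesGradient (quadraticGrad m ℓ a)
      (fun j _ => a • EuclideanSpace.single ((0 : Fin 1), j) (1 : ℝ))
      (fun t V => ∃ J : Finset (Fin m), J.card ≤ t ∧ V = knownSubspace 1 0 J)
      ((m + 1) / 2) γ where
  start := ⟨_, ∅, by simp, rfl⟩
  common_mem := by
    rintro t _ ⟨J, -, rfl⟩ y hy ⟨i, j⟩ hb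
    have h1 : (∑ l : Fin m, a • EuclideanSpace.single ((0 : Fin 1), l) (1 : ℝ)) (i, j) = a := by
      simp [Pi.single_apply, Fin.fin_one_eq_zero i]
    rw [PiLp.add_apply, PiLp.smul_apply, h1, quadraticGrad_apply hm, hy _ hb]
    simp
  step := by
    rintro t _ ⟨J, hJ, rfl⟩ y hy j
    refine ⟨_, knownSubspace_mono (Finset.subset_insert j J), ⟨insert j J,
      (Finset.card_insert_le _ _).trans (by omega), rfl⟩, ?_⟩
    rintro ⟨i, l⟩ (hb | ⟨-, hb⟩)
    · have := i.2
      simp at hb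
    · have : l ≠ j := fun h => hb (Finset.mem_insert.mpr (Or.inl h))
      simp [this]
  le_norm := by
    rintro t ht _ ⟨J, hJ, rfl⟩ y hy
    have hm0 : (0 : ℝ) < m := by exact_mod_cast hm
    refine le_of_sq_le_sq ?_ (norm_nonneg _)
    rw [EuclideanSpace.real_norm_sq_eq, Fintype.sum_prod_type, Fin.sum_univ_one]
    have h1 : ∀ j ∈ Jᶜ, quadraticGrad m ℓ a y (0, j) ^ 2 = ((m : ℝ)⁻¹ * a) ^ 2 := fun j hj => by
      rw [quadraticGrad_apply hm, hy (0, j) (Or.inr ⟨rfl, Finset.mem_compl.mp hj⟩)]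
      ring
    have h2 : (m : ℝ) / 2 ≤ Jᶜ.card := by
      rw [Finset.card_compl, Fintype.card_fin]
      have h3 : m ≤ 2 * (m - J.card) := by omega
      have h4 : (m : ℝ) ≤ 2 * ((m - J.card : ℕ) : ℝ) := by exact_mod_cast h3
      linarith
    calc γ ^ 2 ≤ m / 2 * ((m : ℝ)⁻¹ * a) ^ 2 := by
          rw [show (m : ℝ) / 2 * ((m : ℝ)⁻¹ * a) ^ 2 = a ^ 2 / (2 * m) by field_simp,
            le_div_iff₀ (by positivity)]
          exact ha
      _ ≤ Jᶜ.card * ((m : ℝ)⁻¹ * a) ^ 2 := by gcongr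
      _ = ∑ j ∈ Jᶜ, quadraticGrad m ℓ a y (0, j) ^ 2 := by
          rw [Finset.sum_congr rfl h1, Finset.sum_const, nsmul_eq_mul]
      _ ≤ ∑ j, quadraticGrad m ℓ a y (0, j) ^ 2 := Finset.sum_le_sum_of_subset_of_nonneg
          (Finset.subset_univ _) fun _ _ _ => sq_nonneg _

theorem exists_quadratic_min (hm : 1 ≤ m) (hℓ : 0 < ℓ) :
    ∃ y₁, (∀ y, quadratic m ℓ a y₁ ≤ quadratic m ℓ a y) ∧
      quadratic m ℓ a 0 - quadratic m ℓ a y₁ = a ^ 2 / (2 * ℓ * m) := by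
  have hm0 : (0 : ℝ) < m := by exact_mod_cast hm
  set φ : ℝ → ℝ := fun t => m * ℓ / 2 * t ^ 2 - a * t with hφ
  have h1 : ∀ t, φ (a / (m * ℓ)) ≤ φ t := fun t => by
    have : φ t - φ (a / (m * ℓ)) = m * ℓ / 2 * (t - a / (m * ℓ)) ^ 2 := by
      simp only [hφ]
      field_simp
      ring
    have h2 : 0 ≤ m * ℓ / 2 * (t - a / (m * ℓ)) ^ 2 := by positivity
    linarith
  refine ⟨WithLp.toLp 2 fun _ => a / (m * ℓ), fun y => ?_, ?_⟩
  · exact mul_le_mul_of_nonneg_left (Finset.sum_le_sum fun b _ => h1 _) (by positivity)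
  · simp [quadratic, coordAvg]
    field_simp
    ring

end Quadratic

/-! ### Choice of parameters -/

/-- The smallest admissible ratio of `σ ^ 2` to `m ε ^ 2` when there are at least two groups. -/
def varianceFactor : ℝ := 4608 * weightBound ^ 2

/-- The value of `Δ₀ L / (ε ^ 2 √m)` that each block of the chain consumes. -/
def lengthFactor : ℝ := 576 * √(chainBound + 128 * weightBound ^ 2)

theorem sixteen_le_varianceFactor : 16 ≤ varianceFactor := by
  have := one_le_weightBound
  unfold varianceFactor
  nlinarith

theorem lengthFactor_pos : 0 < lengthFactor := by
  unfold lengthFactor chainBound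
  positivity

/-- Values are scaled so that the initial gap is `Δ₀`, and the domain so that gradients of size
`1 / (12 √m)` become gradients of size `2 ε`; smoothness then limits the number `T` of blocks. -/
theorem hasHardProblem_chain {T m : ℕ} (hT : 1 ≤ T) (hm : 1 ≤ m) {n : ℕ∞} (hmn : (m : ℕ∞) ≤ n)
    {L Δ₀ σ ε : ℝ} (hΔ : 0 < Δ₀) (hε : 0 < ε)
    (hvar : m = 1 ∨ varianceFactor * m * ε ^ 2 ≤ σ ^ 2)
    (hlen : ((T : ℝ) - 1 / 2) * (lengthFactor * ε ^ 2 * √m) ≤ Δ₀ * L) :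
    HasHardProblem.{u} n L Δ₀ σ ε ((T * ((m + 1) / 2) : ℕ) / 2) := by
  have hm1 : (1 : ℝ) ≤ m := by exact_mod_cast hm
  have hm0 : (0 : ℝ) < m := by linarith
  have hT1 : (1 : ℝ) ≤ T := by exact_mod_cast hT
  have hsm : 0 < √(m : ℝ) := Real.sqrt_pos.mpr hm0
  have hsm2 : √(m : ℝ) ^ 2 = m := Real.sq_sqrt hm0.le
  have hT2 : (0 : ℝ) < T - 1 / 2 := by linarith
  set μ := Δ₀ / (T - 1 / 2) with hμdef
  have hμ : 0 < μ := div_pos hΔ hT2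
  set s := μ / (24 * ε * √m) with hsdef
  have hs : 0 < s := by positivity
  have hμs : μ / s = 24 * ε * √m := by
    rw [hsdef]
    field_simp
  obtain ⟨y₁, hy₁⟩ := exists_chain_eq (T := T) hm
  have hlen' : lengthFactor * ε ^ 2 * √m ≤ μ * L := by
    rw [hμdef, div_mul_eq_mul_div, le_div_iff₀ hT2]
    linarith
  refine exists_stochasticProblem_of_noiseModel hm hmn (isNoiseModel_chain hm)
    (hidesGradient_chain hm) hμ hs hε (hvar.imp_right fun h => ?_) ?_ ?_ (y₁ := y₁) (fun y => ?_)
    ?_ ?_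
  · rw [hμs, mul_pow, hsm2]
    unfold varianceFactor at h
    linarith
  · unfold chainBound
    positivity
  · set R := √(chainBound + 128 * weightBound ^ 2) with hR
    have hR2 : R ^ 2 = chainBound + 128 * weightBound ^ 2 := Real.sq_sqrt (by
      unfold chainBound
      positivity)
    have h1 : chainBound / (m : ℝ) ^ 2 + 2 * (64 * weightBound ^ 2 / m) ≤ R ^ 2 / m := by
      rw [hR2, add_div]
      have : chainBound / (m : ℝ) ^ 2 ≤ chainBound / m := by
        unfold chainBound
        gcongr
        nlinarith
      have e : 2 * (64 * weightBound ^ 2 / (m : ℝ)) = 128 * weightBound ^ 2 / m := by ring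
      linarith
    have h2 : μ / s ^ 2 = 576 * ε ^ 2 * m / μ := by
      rw [hsdef, div_pow, mul_pow, mul_pow, hsm2]
      field_simp
      norm_num
    calc (μ / s ^ 2) ^ 2 * (chainBound / (m : ℝ) ^ 2 + 2 * (64 * weightBound ^ 2 / m))
        ≤ (μ / s ^ 2) ^ 2 * (R ^ 2 / m) := by gcongr
      _ = (lengthFactor * ε ^ 2 * √m / μ) ^ 2 := by
          rw [h2, lengthFactor, ← hR]
          calc (576 * ε ^ 2 * m / μ) ^ 2 * (R ^ 2 / m)
              = 576 ^ 2 * R ^ 2 * ε ^ 4 * m / μ ^ 2 := by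
                clear_value μ
                field_simp
            _ = (576 * R * ε ^ 2 * √m / μ) ^ 2 := by
                rw [← hsm2]
                simp only [Real.sqrt_sq hsm.le]
                ring
      _ ≤ L ^ 2 := by
          refine pow_le_pow_left₀ ?_ ?_ 2
          · have := lengthFactor_pos
            positivity
          · rw [div_le_iff₀ hμ]
            linarith
  · rw [hy₁]
    exact neg_le_chain y
  · rw [chain_zero hT hm, hy₁, hμdef, show -(1 / 2 : ℝ) - -(T : ℝ) = T - 1 / 2 by ring,
      div_mul_cancel₀ _ hT2.ne']
  · rw [hμs]
    refine le_of_eq ?_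
    field_simp
    norm_num

/-- The quadratic with linear noise covers the case in which `Δ₀ L / ε ^ 2` does not even pay for
one block of the chain. -/
theorem hasHardProblem_quadratic {m : ℕ} (hm : 1 ≤ m) {n : ℕ∞} (hmn : (m : ℕ∞) ≤ n)
    {L Δ₀ σ ε : ℝ} (hΔ : 0 < Δ₀) (hε : 0 < ε)
    (hvar : m = 1 ∨ varianceFactor * m * ε ^ 2 ≤ σ ^ 2) (hsmall : 4 * ε ^ 2 ≤ Δ₀ * L) :
    HasHardProblem.{u} n L Δ₀ σ ε (((m + 1) / 2 : ℕ) / 2) := by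
  have hm0 : (0 : ℝ) < m := by exact_mod_cast hm
  set ℓ := 4 * ε ^ 2 / Δ₀ with hℓdef
  have hℓ : 0 < ℓ := by positivity
  have hℓL : ℓ ≤ L := by
    rw [hℓdef, div_le_iff₀ hΔ]
    linarith
  set a := √(8 * m) * ε with ha
  have ha2 : a ^ 2 = 8 * m * ε ^ 2 := by
    rw [ha, mul_pow, Real.sq_sqrt (by positivity)]
  obtain ⟨y₁, hmin, hgap⟩ := exists_quadratic_min (a := a) hm hℓ
  refine exists_stochasticProblem_of_noiseModel hm hmn (isNoiseModel_quadratic (ℓ := ℓ) (a := a) hm)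
    (hidesGradient_quadratic hm (γ := 2 * ε) (by rw [ha2]; linarith)) one_pos
    one_pos hε (hvar.imp_right fun h => ?_) (by positivity) ?_ hmin ?_ (by simp)
  · have h1 := mul_le_mul_of_nonneg_right sixteen_le_varianceFactor
      (by positivity : 0 ≤ m * ε ^ 2)
    rw [ha2]
    linarith
  · have := pow_le_pow_left₀ hℓ.le hℓL 2
    linarith
  · rw [hgap, ha2, hℓdef]
    field_simp
    norm_num

/-- A number `m` of groups comparable to `min {σ ^ 2 / ε ^ 2, n}` that the variance bound and the
size of the problem permit. -/
theorem exists_numGroups {Q : ℝ} (hQ : 1 ≤ Q) (σ : ℝ) {ε : ℝ} (hε : 0 < ε) {n : ℕ∞} (hn : 0 < n) :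
    ∃ m : ℕ, 1 ≤ m ∧ (m : ℕ∞) ≤ n ∧ (m = 1 ∨ Q * m * ε ^ 2 ≤ σ ^ 2) ∧
      minBatch σ ε n ≤ 2 * Q * m := by
  have hQ0 : 0 < Q := by linarith
  set β := σ ^ 2 / (Q * ε ^ 2) with hβ
  have hβ0 : 0 ≤ β := by positivity
  have hσ : σ ^ 2 / ε ^ 2 = Q * β := by
    rw [hβ]
    field_simp
  have hvar : ∀ m : ℕ, m ≤ ⌊β⌋₊ → Q * m * ε ^ 2 ≤ σ ^ 2 := fun m hm => by
    have h1 : (m : ℝ) ≤ β := (Nat.cast_le.mpr hm).trans (Nat.floor_le hβ0)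
    rw [hβ, le_div_iff₀ (by positivity)] at h1
    linarith
  have hfloor : ∀ m : ℕ, 1 ≤ m → ⌊β⌋₊ ≤ m → Q * β ≤ 2 * Q * m := fun m h1 h2 => by
    have h3 := Nat.lt_floor_add_one β
    have h4 : (⌊β⌋₊ : ℝ) ≤ m := by exact_mod_cast h2
    have h5 : (1 : ℝ) ≤ m := by exact_mod_cast h1
    nlinarith
  have hb1 : minBatch σ ε n ≤ σ ^ 2 / ε ^ 2 := by
    have h := ENNReal.toReal_mono ENNReal.ofReal_ne_top
      (min_le_left (ENNReal.ofReal (σ ^ 2 / ε ^ 2)) (n : ℝ≥0∞))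
    rwa [ENNReal.toReal_ofReal (by positivity)] at h
  rw [hσ] at hb1
  by_cases hcase : n ≤ (⌊β⌋₊ : ℕ∞)
  · -- the size of the problem is the binding constraint, and every index is its own group
    obtain ⟨N, rfl⟩ := ENat.ne_top_iff_exists.mp (ne_top_of_le_ne_top (ENat.natCast_ne_top _) hcase)
    have hN : 1 ≤ N := by exact_mod_cast hn
    have hNf : N ≤ ⌊β⌋₊ := by exact_mod_cast hcase
    refine ⟨N, hN, le_rfl, Or.inr (hvar N hNf), ?_⟩
    have h := ENNReal.toReal_mono (by simp)
      (min_le_right (ENNReal.ofReal (σ ^ 2 / ε ^ 2)) (((N : ℕ∞) : ℝ≥0∞)))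
    have hb2 : minBatch σ ε N ≤ N := by simpa [minBatch] using h
    have h5 : (0 : ℝ) ≤ N := Nat.cast_nonneg N
    nlinarith
  · have hlt : (⌊β⌋₊ : ℕ∞) < n := not_le.mp hcase
    refine ⟨max 1 ⌊β⌋₊, le_max_left _ _, ?_, ?_,
      hb1.trans (hfloor _ (le_max_left _ _) (le_max_right _ _))⟩
    · rcases le_total 1 ⌊β⌋₊ with h | h
      · rw [max_eq_right h]
        exact hlt.le
      · rw [max_eq_left h]
        exact_mod_cast Order.one_le_iff_pos.mpr hn
    · rcases le_total 1 ⌊β⌋₊ with h | h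
      · rw [max_eq_right h]
        exact Or.inr (hvar _ le_rfl)
      · exact Or.inl (max_eq_left h)

end

theorem corollary5 :
    ∃ c > (0 : ℝ), ∃ c₁ > (0 : ℝ),
      ∀ L : ℝ, 0 < L → ∀ Δ₀ : ℝ, 0 < Δ₀ → ∀ σ : ℝ, 0 < σ → ∀ n : ℕ∞, 0 < n →
      ∀ ε : ℝ, 0 < ε → ε ≤ c₁ * Real.sqrt (Δ₀ * L) →
      ∃ d : ℕ, ∀ x₀ : EuclideanSpace ℝ (Fin d),
        ∃ (Ξ : Type) (_ : MeasurableSpace Ξ) (D : Measure Ξ)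
          (F : EuclideanSpace ℝ (Fin d) → Ξ → ℝ),
          IsSampleLaw n D ∧ IsStochasticProblem D F ∧
          BoundedVariance D F σ ∧ AverageSmooth D F L ∧
          (∃ fstar : ℝ, IsLeast (Set.range (objective D F)) fstar ∧
            objective D F x₀ - fstar = Δ₀) ∧
          ∀ (Ω : Type*) [MeasurableSpace Ω] (P : Measure Ω) [IsProbabilityMeasure P]
            (R : LinearSpanRun F x₀ P), R.FindsApproxSolution D ε →
            ENNReal.ofReal
                (c * (minBatch σ ε n + Δ₀ * L * Real.sqrt (minBatch σ ε n) / ε ^ 2)) ≤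
              R.gradComplexity := by
  set Q := varianceFactor with hQdef
  have hQ : 1 ≤ Q := by linarith [sixteen_le_varianceFactor]
  have hK := lengthFactor_pos
  set C := 2 * Q + 2 * (lengthFactor * √(2 * Q)) with hC
  have hC0 : 0 < C := by positivity
  refine ⟨1 / (4 * C), by positivity, 1 / 2, by norm_num, ?_⟩
  intro L hL Δ₀ hΔ σ hσ n hn ε hε hεsmall
  change HasHardProblem n L Δ₀ σ ε _
  obtain ⟨m, hm, hmn, hvar, hb⟩ := exists_numGroups hQ σ hε hn
  set b := minBatch σ ε n with hbdef
  have hb0 : 0 ≤ b := ENNReal.toReal_nonneg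
  have hm0 : (0 : ℝ) < m := by exact_mod_cast hm
  have hsm : 0 < √(m : ℝ) := Real.sqrt_pos.mpr hm0
  have hhalf : (m : ℝ) / 2 ≤ ((m + 1) / 2 : ℕ) := by
    have h1 : m ≤ 2 * ((m + 1) / 2) := by omega
    have h2 : (m : ℝ) ≤ 2 * ((m + 1) / 2 : ℕ) := by exact_mod_cast h1
    linarith
  -- `X` is the number of blocks that a chain with `m` groups can afford.
  set X := Δ₀ * L / (lengthFactor * ε ^ 2 * √m) with hX
  have hX0 : 0 < X := by positivity
  have hΔLX : Δ₀ * L = X * (lengthFactor * ε ^ 2 * √m) := by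
    rw [hX]
    field_simp
  have hsb : √b ≤ √(2 * Q) * √m := by
    rw [← Real.sqrt_mul (by positivity)]
    exact Real.sqrt_le_sqrt hb
  have htotal : b + Δ₀ * L * √b / ε ^ 2 ≤ m * (2 * Q + X * (lengthFactor * √(2 * Q))) := by
    have h1 : Δ₀ * L * √b / ε ^ 2 = X * lengthFactor * √m * √b := by
      rw [hΔLX]
      field_simp
    have h2 : X * lengthFactor * √m * √b ≤ X * lengthFactor * √m * (√(2 * Q) * √m) := by gcongr
    have h3 : X * lengthFactor * √m * (√(2 * Q) * √m) =
        m * (X * (lengthFactor * √(2 * Q))) := by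
      rw [show X * lengthFactor * √m * (√(2 * Q) * √m) =
        √(m : ℝ) ^ 2 * (X * (lengthFactor * √(2 * Q))) by ring, Real.sq_sqrt hm0.le]
    linarith
  have hP : 0 ≤ lengthFactor * √(2 * Q) := by positivity
  -- The chain has `⌊X + 1 / 2⌋` blocks; with none of them, the term `b` dominates.
  rcases le_or_gt (1 / 2) X with hcase | hcase
  · set T := ⌊X + 1 / 2⌋₊ with hT
    have hT1 : 1 ≤ T := Nat.le_floor (by push_cast; linarith)
    have hTX : (T : ℝ) ≤ X + 1 / 2 := Nat.floor_le (by positivity)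
    have hTX' : X + 1 / 2 < T + 1 := Nat.lt_floor_add_one _
    have hT1' : (1 : ℝ) ≤ T := by exact_mod_cast hT1
    refine (hasHardProblem_chain hT1 hm hmn hΔ hε hvar ?_).mono ?_
    · rw [hΔLX]
      gcongr
      linarith
    · rw [div_mul_eq_mul_div, one_mul, div_le_iff₀ (by positivity)]
      have h1 : 2 * Q + X * (lengthFactor * √(2 * Q)) ≤ T * C := by
        have h2 : X * (lengthFactor * √(2 * Q)) ≤ 2 * T * (lengthFactor * √(2 * Q)) := by
          gcongr
          linarith
        rw [hC]
        nlinarith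
      have h2 : (m : ℝ) * (2 * Q + X * (lengthFactor * √(2 * Q))) ≤ m * (T * C) := by gcongr
      have h3 : (m : ℝ) / 2 * (T * C) ≤ ((m + 1) / 2 : ℕ) * (T * C) := by gcongr
      rw [Nat.cast_mul]
      linarith
  · refine (hasHardProblem_quadratic hm hmn hΔ hε hvar ?_).mono ?_
    · have h1 := pow_le_pow_left₀ hε.le hεsmall 2
      rw [mul_pow, Real.sq_sqrt (by positivity)] at h1
      linarith
    · rw [div_mul_eq_mul_div, one_mul, div_le_iff₀ (by positivity)]
      have h1 : 2 * Q + X * (lengthFactor * √(2 * Q)) ≤ C := by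
        rw [hC]
        nlinarith
      have h2 : (m : ℝ) * (2 * Q + X * (lengthFactor * √(2 * Q))) ≤ m * C := by gcongr
      have h3 : (m : ℝ) / 2 * C ≤ ((m + 1) / 2 : ℕ) * C := by gcongr
      linarith
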